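/- Let $q\ge 4$ be a prime power and let $\mathcal H_q$ be the Hermitian curve over $\mathbb F_{q^2}$ with homogeneous equation $X_2^qX_3+X_2X_3^q-X_1^{q+1}=0$ and affine equation $y^q+y=x^{q+1}$, where $x=X_1/X_3$, $y=X_2/X_3$. Let $P_2,\dots,P_q$ be the points $(0:b:1)$ with $b^q+b=0$, $b\neq 0$ (the points of $\mathcal H_q$ on the line $X_1=0$ other than $(0:0:1)$ and $(0:1:0)$), and for an integer $2\le m\le q-1$ put $\mathtt G=m(P_2+\dots+P_q)$. Let $\omega$ be a generator of $\mathbb F_{q^2}^*$, let $u,v\in\mathbb F_{q^2}$ with $u\ne 0$ and $v^q+v=u^{q+1}$, let $Q_i=(\omega^iu:\omega^{(q+1)i}v:1)$ for $i=1,\dots,q^2-1$, and put $D=\{Q_1,\dots,Q_{q^2-1}\}$ and $\mathtt D=Q_1+\dots+Q_{q^2-1}$. Let $\mathcal L(\mathtt G)=\{f\in\mathbb F_{q^2}(x,y) : f=0 \text{ or } \operatorname{div}(f)+\mathtt G\succcurlyeq 0\}$ and $$C_{\mathcal L}(\mathtt D,\mathtt G)=\{(f(Q_1),\dots,f(Q_{q^2-1}))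 : f\in\mathcal L(\mathtt G)\}\subseteq \mathbb F_{q^2}^{\,q^2-1}.$$ If $m=3$, then the minimum distance of $C_{\mathcal L}(\mathtt D,\mathtt G)$ equals $q^2-q-2$; that is, it attains the upper bound $q^2-1-(m-2)(q+1)$. Moreover, every curve $X_2X_3\,g(X_1,X_2,X_3)+\varepsilon X_1^3=0$, where $\varepsilon\in\mathbb F_{q^2}$, $g\in\mathbb F_{q^2}[X_1,X_2,X_3]$ is zero or homogeneous of degree $1$, and the left-hand side is not the zero polynomial, meets $D$ in at most $q+1$ points. -/

import Mathlib

open scoped Polynomial LinearAlgebra.Projectivization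

noncomputable section

namespace HermitianCode

/-! ### The Hermitian curve and its points over the algebraic closure -/

/-- The form `X₂^q X₃ + X₂ X₃^q - X₁^(q+1)`; the coordinates `X₁, X₂, X₃` are the variables
`X 0, X 1, X 2`. -/
def hermitianForm (q : ℕ) (F : Type*) [Field F] : MvPolynomial (Fin 3) F :=
  MvPolynomial.X 1 ^ q * MvPolynomial.X 2 + MvPolynomial.X 1 * MvPolynomial.X 2 ^ q
    - MvPolynomial.X 0 ^ (q + 1)

/-- A homogeneous form with coefficients in `F` vanishes at a point of the projective plane over
the algebraic closure of `F`. -/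
def Vanishes {F : Type*} [Field F] (a : MvPolynomial (Fin 3) F)
    (P : ℙ (AlgebraicClosure F) (Fin 3 → AlgebraicClosure F)) : Prop :=
  MvPolynomial.aeval P.rep a = 0

/-- The points of the Hermitian curve in the projective plane over the algebraic closure. -/
def Point (q : ℕ) (F : Type*) [Field F] : Type _ :=
  {P : ℙ (AlgebraicClosure F) (Fin 3 → AlgebraicClosure F) // Vanishes (hermitianForm q F) P}

theorem affineVec_ne_zero {F : Type*} [Field F] (a b : F) :
    ![algebraMap F (AlgebraicClosure F) a, algebraMap F (AlgebraicClosure F) b, 1] ≠ 0 :=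
  fun h => by simpa using congrFun h 2

/-- The affine point `(a : b : 1)` of the projective plane, with `a, b ∈ F`. -/
def affineProj {F : Type*} [Field F] (a b : F) :
    ℙ (AlgebraicClosure F) (Fin 3 → AlgebraicClosure F) :=
  Projectivization.mk (AlgebraicClosure F)
    ![algebraMap F (AlgebraicClosure F) a, algebraMap F (AlgebraicClosure F) b, 1]
    (affineVec_ne_zero a b)

theorem affineProj_vanishes (q : ℕ) {F : Type*} [Field F] {a b : F}
    (h : b ^ q + b = a ^ (q + 1)) : Vanishes (hermitianForm q F) (affineProj a b) := by
  obtain ⟨c, hc⟩ := Projectivization.exists_smul_eq_mk_rep (AlgebraicClosure F)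
    (![algebraMap F (AlgebraicClosure F) a, algebraMap F (AlgebraicClosure F) b, 1])
    (affineVec_ne_zero a b)
  have h' := congrArg (algebraMap F (AlgebraicClosure F)) h
  simp only [map_add, map_pow] at h'
  unfold Vanishes affineProj hermitianForm
  rw [← hc]
  simp only [map_sub, map_add, map_mul, map_pow, MvPolynomial.aeval_X, Pi.smul_apply,
    Units.smul_def, smul_eq_mul, Matrix.cons_val_zero, Matrix.cons_val_one, Matrix.cons_val]
  linear_combination (c : AlgebraicClosure F) ^ (q + 1) * h'

/-- The affine `F`-rational point `(a : b : 1)` of the Hermitian curve. -/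
def affinePoint (q : ℕ) {F : Type*} [Field F] (a b : F) (h : b ^ q + b = a ^ (q + 1)) :
    Point q F :=
  ⟨affineProj a b, affineProj_vanishes q h⟩

/-! ### The function field `F(x, y)`, `y^q + y = x^(q+1)` -/

/-- The affine equation `X^(q+1) - (Y^q + Y)`, as a polynomial in `X` over `F[Y]`. -/
def affineEquation (q : ℕ) (F : Type*) [Field F] : F[X][X] :=
  Polynomial.X ^ (q + 1) - Polynomial.C (Polynomial.X ^ q + Polynomial.X)

/-- The affine equation is irreducible, so the coordinate ring below is a domain. -/
theorem affineEquation_irreducible {q : ℕ} (hq : 2 ≤ q) (F : Type*) [Field F] :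
    Irreducible (affineEquation q F) := by
  have hm : (affineEquation q F).Monic := Polynomial.monic_X_pow_sub_C _ (Nat.succ_ne_zero q)
  have hd : (affineEquation q F).natDegree = q + 1 := Polynomial.natDegree_X_pow_sub_C
  have hp : (Ideal.span {(Polynomial.X : F[X])}).IsPrime :=
    (Ideal.span_singleton_prime Polynomial.X_ne_zero).2 Polynomial.prime_X
  have hcoeff : ∀ n < q + 1, (affineEquation q F).coeff n =
      if n = 0 then -(Polynomial.X ^ q + Polynomial.X) else 0 := by
    intro n hn
    simp only [affineEquation, Polynomial.coeff_sub, Polynomial.coeff_X_pow, Polynomial.coeff_C]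
    rw [if_neg hn.ne]
    split_ifs <;> simp
  refine Polynomial.irreducible_of_eisenstein_criterion hp ?_ ?_ ?_ ?_ hm.isPrimitive
  · rw [hm.leadingCoeff]
    exact fun h => hp.ne_top ((Ideal.eq_top_iff_one _).2 h)
  · intro n hn
    rw [Polynomial.degree_eq_natDegree hm.ne_zero, hd] at hn
    rw [hcoeff n (by exact_mod_cast hn), Ideal.mem_span_singleton]
    split_ifs
    · exact (dvd_add (dvd_pow_self _ (by omega)) dvd_rfl).neg_right
    · exact dvd_zero _
  · rw [← Polynomial.natDegree_pos_iff_degree_pos, hd]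
    omega
  · rw [hcoeff 0 (by omega), if_pos rfl, Ideal.span_singleton_pow, Ideal.mem_span_singleton,
      dvd_neg, dvd_add_right (pow_dvd_pow _ hq), Polynomial.X_pow_dvd_iff]
    intro h
    simpa using h 1 one_lt_two

/-- The affine coordinate ring `F[X, Y] / (Y^q + Y - X^(q+1))`. -/
abbrev CoordRing (q : ℕ) (F : Type*) [Field F] : Type _ := AdjoinRoot (affineEquation q F)

/-- The field of functions on the Hermitian curve that are defined over `F`. -/
abbrev FunField (q : ℕ) (F : Type*) [Field F] : Type _ := FractionRing (CoordRing q F)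

/-- The coordinate function `x`. -/
def coordX (q : ℕ) (F : Type*) [Field F] : FunField q F :=
  algebraMap (CoordRing q F) (FunField q F) (AdjoinRoot.root (affineEquation q F))

/-- The coordinate function `y`. -/
def coordY (q : ℕ) (F : Type*) [Field F] : FunField q F :=
  algebraMap (CoordRing q F) (FunField q F)
    (AdjoinRoot.of (affineEquation q F) Polynomial.X)

/-- The function `a(x, y, 1)`. -/
def dehom (q : ℕ) {F : Type*} [Field F] (a : MvPolynomial (Fin 3) F) : FunField q F :=
  MvPolynomial.aeval ![coordX q F, coordY q F, 1] a

/-- The local ring at `P`: the functions `a(x, y, 1) / b(x, y, 1)` with `a, b` homogeneous of the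
same degree and `b(P) ≠ 0`. -/
def localRing {q : ℕ} {F : Type*} [Field F] (P : Point q F) : Subalgebra F (FunField q F) where
  carrier := {f | ∃ (d : ℕ) (a b : MvPolynomial (Fin 3) F), a.IsHomogeneous d ∧
    b.IsHomogeneous d ∧ ¬ Vanishes b P.1 ∧ f * dehom q b = dehom q a}
  mul_mem' := by
    rintro f g ⟨d, a, b, ha, hb, hbP, h⟩ ⟨e, a', b', ha', hb', hbP', h'⟩
    refine ⟨d + e, a * a', b * b', ha.mul ha', hb.mul hb', ?_, ?_⟩
    · simpa [Vanishes] using And.intro hbP hbP'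
    · simp only [dehom, map_mul] at *
      rw [← h, ← h']; ring
  add_mem' := by
    rintro f g ⟨d, a, b, ha, hb, hbP, h⟩ ⟨e, a', b', ha', hb', hbP', h'⟩
    refine ⟨d + e, a * b' + b * a', b * b', (ha.mul hb').add (hb.mul ha'), hb.mul hb', ?_, ?_⟩
    · simpa [Vanishes] using And.intro hbP hbP'
    · simp only [dehom, map_mul, map_add] at *
      rw [← h, ← h']; ring
  algebraMap_mem' c := by
    refine ⟨0, MvPolynomial.C c, 1, MvPolynomial.isHomogeneous_C _ _,
      MvPolynomial.isHomogeneous_one _ _, by simp [Vanishes], ?_⟩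
    simp [dehom]

/-- The maximal ideal of the local ring at `P`, as a submodule of the function field: the
functions `a(x, y, 1) / b(x, y, 1)` as above with moreover `a(P) = 0`. -/
def maxIdeal {q : ℕ} {F : Type*} [Field F] (P : Point q F) :
    Submodule (localRing P) (FunField q F) where
  carrier := {f | ∃ (d : ℕ) (a b : MvPolynomial (Fin 3) F), a.IsHomogeneous d ∧
    b.IsHomogeneous d ∧ ¬ Vanishes b P.1 ∧ Vanishes a P.1 ∧ f * dehom q b = dehom q a}
  zero_mem' := ⟨0, 0, 1, MvPolynomial.isHomogeneous_zero _ _ _,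
    MvPolynomial.isHomogeneous_one _ _, by simp [Vanishes], by simp [Vanishes], by simp [dehom]⟩
  add_mem' := by
    rintro f g ⟨d, a, b, ha, hb, hbP, haP, h⟩ ⟨e, a', b', ha', hb', hbP', haP', h'⟩
    refine ⟨d + e, a * b' + b * a', b * b', (ha.mul hb').add (hb.mul ha'), hb.mul hb', ?_, ?_, ?_⟩
    · simpa [Vanishes] using And.intro hbP hbP'
    · simp only [Vanishes, map_add, map_mul] at *
      rw [haP, haP']; ring
    · simp only [dehom, map_mul, map_add] at *
      rw [← h, ← h']; ring
  smul_mem' := by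
    rintro ⟨f, d, a, b, ha, hb, hbP, h⟩ g ⟨e, a', b', ha', hb', hbP', haP', h'⟩
    refine ⟨d + e, a * a', b * b', ha.mul ha', hb.mul hb', ?_, ?_, ?_⟩
    · simpa [Vanishes] using And.intro hbP hbP'
    · simp only [Vanishes, map_mul] at *
      rw [haP']; ring
    · simp only [dehom, map_mul, Subalgebra.smul_def, smul_eq_mul] at h h' ⊢
      rw [← h, ← h']; ring

/-! ### Divisors, Riemann–Roch spaces and codes -/

/-- The functions `f` with `ord_P f ≥ n` (and `f = 0`), that is the power `𝔪_P ^ n` of the maximal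
ideal of the local ring at `P`; for `n = -k < 0` this is `{f | f * 𝔪_P ^ k ⊆ 𝒪_P}`.
(The curve is smooth, so the local ring is a discrete valuation ring.) -/
def ordGE {q : ℕ} {F : Type*} [Field F] (P : Point q F) :
    ℤ → Submodule (localRing P) (FunField q F)
  | Int.ofNat n => maxIdeal P ^ n
  | Int.negSucc n => 1 / maxIdeal P ^ (n + 1)

/-- The Riemann–Roch space `ℒ(G) = {f | div f + G ≥ 0}` of functions defined over `F`. -/
def riemannRoch {q : ℕ} {F : Type*} [Field F] (G : Point q F →₀ ℤ) :
    Submodule F (FunField q F) :=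
  ⨅ P : Point q F, (ordGE P (-(G P))).restrictScalars F

/-- The function `f` is regular at `P` and takes there the value `c ∈ F`. -/
def HasValue {q : ℕ} {F : Type*} [Field F] (P : Point q F) (f : FunField q F) (c : F) : Prop :=
  f - algebraMap F (FunField q F) c ∈ maxIdeal P

/-- The functional code `C_ℒ(D, G)`: all words `(f(Q₁), …, f(Qₙ))` with `f ∈ ℒ(G)`, where
`D = (Q₁, …, Qₙ)`. -/
def agCode {q n : ℕ} {F : Type*} [Field F] (D : Fin n → Point q F) (G : Point q F →₀ ℤ) :
    Submodule F (Fin n → F) where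
  carrier := {w | ∃ f ∈ riemannRoch G, ∀ i, HasValue (D i) f (w i)}
  zero_mem' := ⟨0, Submodule.zero_mem _, fun i => by simp [HasValue]⟩
  add_mem' := by
    rintro w w' ⟨f, hf, h⟩ ⟨f', hf', h'⟩
    refine ⟨f + f', Submodule.add_mem _ hf hf', fun i => ?_⟩
    have := Submodule.add_mem _ (h i) (h' i)
    simp only [HasValue, Pi.add_apply, map_add]
    convert this using 1; ring
  smul_mem' := by
    rintro c w ⟨f, hf, h⟩
    refine ⟨c • f, Submodule.smul_mem _ c hf, fun i => ?_⟩
    have := ((maxIdeal (D i)).restrictScalars F).smul_mem c (h i)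
    simp only [HasValue, Pi.smul_apply, smul_eq_mul, map_mul]
    rw [smul_sub, Algebra.smul_def c (algebraMap F (FunField q F) (w i))] at this
    exact this

/-- `d` is the minimum distance of the code `C`. -/
def IsMinDistance {n : ℕ} {F : Type*} [Field F] [DecidableEq F] (C : Submodule F (Fin n → F))
    (d : ℕ) : Prop :=
  IsLeast {e | ∃ w ∈ C, ∃ w' ∈ C, w ≠ w' ∧ hammingDist w w' = e} d

/-! ### The divisors `G` and `D` -/

/-- `G = m (P₂ + ⋯ + P_q)`, where `P₂, …, P_q` are the points `(0 : b : 1)` with `b^q + b = 0` and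
`b ≠ 0`, that is the points of the curve on the line `X₁ = 0` other than `(0 : 0 : 1)` and
`(0 : 1 : 0)`. -/
def divG (q : ℕ) (F : Type*) [Field F] [Fintype F] [DecidableEq F] (m : ℕ) : Point q F →₀ ℤ :=
  ∑ b : {b : F // b ^ q + b = 0 ∧ b ≠ 0},
    Finsupp.single (affinePoint q 0 b.1 (by rw [b.2.1, zero_pow (Nat.succ_ne_zero q)])) (m : ℤ)

theorem orbit_eq {q : ℕ} {F : Type*} [Field F] [Fintype F] (hF : Fintype.card F = q ^ 2)
    {u v : F} (huv : v ^ q + v = u ^ (q + 1)) (w : F) :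
    (w ^ (q + 1) * v) ^ q + w ^ (q + 1) * v = (w * u) ^ (q + 1) := by
  have h : w ^ (q ^ 2) = w := hF ▸ FiniteField.pow_card w
  have h2 : (w ^ (q + 1)) ^ q = w ^ (q + 1) := by
    rw [← pow_mul, show (q + 1) * q = q ^ 2 + q by ring, pow_add, h, pow_succ']
  rw [mul_pow, h2, mul_pow, ← huv]; ring

/-- The points `Qᵢ = (ω^i u : ω^((q+1)i) v : 1)`, `i = 1, …, q² - 1`. -/
def divD {q : ℕ} {F : Type*} [Field F] [Fintype F] (hF : Fintype.card F = q ^ 2) (ω : Fˣ)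
    {u v : F} (huv : v ^ q + v = u ^ (q + 1)) (i : Fin (q ^ 2 - 1)) : Point q F :=
  affinePoint q ((ω : F) ^ ((i : ℕ) + 1) * u) (((ω : F) ^ ((i : ℕ) + 1)) ^ (q + 1) * v)
    (orbit_eq hF huv _)

/-- The forms `X₂ X₃ g + ε X₁^m` over `F`, with `g` homogeneous of degree `m - 2`, that are not
identically zero: the equations of the curves (defined over `F`) of the linear system. -/
def linearSystem (F : Type*) [Field F] (m : ℕ) : Set (MvPolynomial (Fin 3) F) :=
  {V | V ≠ 0 ∧ ∃ (g : MvPolynomial (Fin 3) F) (ε : F), g.IsHomogeneous (m - 2) ∧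
    V = MvPolynomial.X 1 * MvPolynomial.X 2 * g + MvPolynomial.C ε * MvPolynomial.X 0 ^ m}

end HermitianCode

end

namespace HermitianCode

/-! ### Finite fields of square order -/

section FiniteField

variable {q : ℕ} {F : Type*} [Field F]

/-! Multiplying `f ∈ ℒ(3(P₂ + ⋯ + P_q))` by `x³` removes every affine pole, so `x³ f` lies in the
coordinate ring. At `(0 : 1 : 0)`, where `x` and `y` have poles of order `q` and `q + 1`, its pole
order is at most `3q`, which leaves the monomials `1, x, y, x², xy, y², x³`. At the origin it
vanishes to order at least 3, which removes `1, x, x²`. Hence `f = (y (a + b x + c y) + ε x³) / x³`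
(`exists_of_mem_riemannRoch`), and codewords and cubics of the linear system are governed by the
same four-parameter family.

On the orbit `x = w u` and `y = w^(q+1) v`, so zeros in `D` correspond to nonzero roots `w ∈ F` of
`A w^(q+1) + B w^(q+2) + D w^(2q+2) + E w³`. The heart of the proof is `card_zeros_le`: there are at
most `q + 1` of them. If `D = 0` or `E = 0`, dividing by a power of `w` leaves degree at most `q +
1`. Otherwise set `t = w^q`; then `t^q = w`, and the equation and its `q`-th power are two cubics in
`w, t`. Eliminating `t` leaves a nonzero polynomial of degree 6 (`card_le_six_of_cubic`), which
suffices for `q ≥ 5`; for `q = 4` squaring in characteristic 2 gives degree 5.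

The bound is attained by `y (y - v) / x³`, which vanishes at the `q + 1` orbit points with `w^(q+1)
= 1`. It lies in the Riemann–Roch space (`mem_riemannRoch_of_mul_eq`) because `x` is a local
parameter at each `P_i` and the curve equation rewrites it without poles at the origin and at
infinity. -/

theorem card_root_set_le {S : Finset F} (p : F[X]) (hp : p ≠ 0) {n : ℕ} (hn : p.natDegree ≤ n)
    (hS : ∀ w ∈ S, p.eval w = 0) : S.card ≤ n := by
  classical
  refine le_trans (le_trans (Finset.card_le_card (t := p.roots.toFinset) fun w hw => ?_)
    (p.roots.toFinset_card_le.trans p.card_roots')) hn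
  simpa [hp] using hS w hw

variable [Fintype F]

/-- That `q` is a prime power is not assumed: `q` divides the order `p ^ n` of `F`. -/
theorem exists_eq_prime_pow (hF : Fintype.card F = q ^ 2) :
    ∃ p k : ℕ, p.Prime ∧ CharP F p ∧ q = p ^ k := by
  obtain ⟨p, hp⟩ := CharP.exists F
  obtain ⟨n, hpp, hn⟩ := FiniteField.card F p
  have hdvd : q ∣ p ^ (n : ℕ) := by
    rw [← hn, hF]; exact dvd_pow_self _ two_ne_zero
  obtain ⟨k, -, hk⟩ := (Nat.dvd_prime_pow hpp).1 hdvd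
  exact ⟨p, k, hpp, hp, hk⟩

/-- Over a field with `q ^ 2` elements, `z ↦ z ^ q` is additive on every algebra. -/
theorem add_pow_of_card (hF : Fintype.card F = q ^ 2) {R : Type*} [CommRing R] [Algebra F R]
    (a b : R) : (a + b) ^ q = a ^ q + b ^ q := by
  obtain ⟨p, k, hp, hc, rfl⟩ := exists_eq_prime_pow hF
  rcases subsingleton_or_nontrivial R with _ | _
  · exact Subsingleton.elim _ _
  have : Fact p.Prime := ⟨hp⟩
  have : CharP R p := charP_of_injective_algebraMap (algebraMap F R).injective p
  exact add_pow_char_pow a b p k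

theorem sub_pow_of_card (hF : Fintype.card F = q ^ 2) {R : Type*} [CommRing R] [Algebra F R]
    (a b : R) : (a - b) ^ q = a ^ q - b ^ q := by
  rw [eq_sub_iff_add_eq, ← add_pow_of_card hF, sub_add_cancel]

open Polynomial in
/-- Bounded number of common zeros of a conjugate pair of cubics. -/
theorem card_le_six_of_cubic (hF : Fintype.card F = q ^ 2) {A B D E : F} (hD : D ≠ 0) (hE : E ≠ 0)
    {S : Finset F} (hS0 : ∀ w ∈ S, w ≠ 0)
    (hS : ∀ w ∈ S, A * w ^ q + B * w ^ (q + 1) + D * w ^ (2 * q + 1) + E * w ^ 2 = 0) :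
    S.card ≤ 6 := by
  have hconj : ∀ w : F, (w ^ q) ^ q = w := fun w => by
    rw [← pow_mul, ← sq, ← hF, FiniteField.pow_card]
  -- With `t = w^q`, the combination `E^q · (equation) - D w · (conjugate equation)` cancels `t² w`
  -- and is linear in `t`: it reads `t K(w) = L w²`.
  set L : F := D * A ^ q - E * E ^ q with hL
  set K : F[X] := C (-(D * D ^ q)) * X ^ 3 + C (-(D * B ^ q)) * X ^ 2 + C (E ^ q * B) * X
    + C (E ^ q * A) with hK
  -- Multiplying the conjugate equation by `K²` and replacing `t K` by `L w²` gives `w p(w) = 0`.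
  set p : F[X] := C (D ^ q * L) * X ^ 3 * K + C (E ^ q * L ^ 2) * X ^ 3 + C (B ^ q * L) * X ^ 2 * K
    + C (A ^ q) * K ^ 2 with hp
  have hpdeg : p.natDegree ≤ 6 := by
    rw [hp, hK]; compute_degree
  -- The terms `X³ K` and `K²` contribute `D (D^q)² (D A^q - L)`, and `D A^q - L = E E^q`, so the
  -- coefficient is nonzero whatever `A` and `B` are.
  have hcoef : p.coeff 6 = D * (D ^ q) ^ 2 * (E * E ^ q) := by
    have : p = C (D * (D ^ q) ^ 2 * (E * E ^ q)) * X ^ 6 +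
        (p - C (D * (D ^ q) ^ 2 * (E * E ^ q)) * X ^ 6) := by ring
    have h5 : (p - C (D * (D ^ q) ^ 2 * (E * E ^ q)) * X ^ 6).natDegree ≤ 5 := by
      have : p - C (D * (D ^ q) ^ 2 * (E * E ^ q)) * X ^ 6 =
        C (D ^ q * L) * X ^ 3 * (C (-(D * B ^ q)) * X ^ 2 + C (E ^ q * B) * X + C (E ^ q * A))
        + C (E ^ q * L ^ 2) * X ^ 3 + C (B ^ q * L) * X ^ 2 * K
        + C (A ^ q) * (2 * C (-(D * D ^ q)) * X ^ 3 *
          (C (-(D * B ^ q)) * X ^ 2 + C (E ^ q * B) * X + C (E ^ q * A))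
          + (C (-(D * B ^ q)) * X ^ 2 + C (E ^ q * B) * X + C (E ^ q * A)) ^ 2) := by
        rw [hp, hK, hL]
        simp only [map_mul, map_neg, map_sub, map_pow]
        ring
      rw [this, hK]
      compute_degree
    rw [this, coeff_add, coeff_C_mul, coeff_X_pow, if_pos rfl,
      coeff_eq_zero_of_natDegree_lt (by omega)]
    ring
  have hp0 : p ≠ 0 := by
    intro h
    rw [h, coeff_zero] at hcoef
    exact mul_ne_zero (mul_ne_zero hD (pow_ne_zero _ (pow_ne_zero _ hD)))
      (mul_ne_zero hE (pow_ne_zero _ hE)) hcoef.symm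
  refine card_root_set_le p hp0 hpdeg fun w hw => ?_
  have hw0 := hS0 w hw
  obtain ⟨t, ht⟩ : ∃ t, t = w ^ q := ⟨_, rfl⟩
  have htq : t ^ q = w := ht ▸ hconj w
  have h1 : A * t + B * (t * w) + D * (t ^ 2 * w) + E * w ^ 2 = 0 := by
    rw [ht, ← hS w hw]; ring
  have h2 : A ^ q * w + B ^ q * (w * t) + D ^ q * (w ^ 2 * t) + E ^ q * t ^ 2 = 0 := by
    have := congrArg (· ^ q) h1
    simp only [add_pow_of_card hF, mul_pow, htq, ← ht] at this
    rw [zero_pow (by rintro rfl; simp at hF)] at this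
    rw [pow_right_comm t, pow_right_comm w, htq, ← ht] at this
    exact this
  have h3 : t * K.eval w = L * w ^ 2 := by
    simp only [hK, hL, eval_add, eval_mul, eval_C, eval_pow, eval_X]
    linear_combination E ^ q * h1 - D * w * h2
  have h4 : w * p.eval w = 0 := by
    simp only [hp, eval_add, eval_mul, eval_C, eval_pow, eval_X]
    linear_combination (K.eval w) ^ 2 * h2 - (D ^ q * w ^ 2 * (K.eval w) + B ^ q * w * K.eval w
      + E ^ q * (t * K.eval w + L * w ^ 2)) * h3
  exact (mul_eq_zero.1 h4).resolve_left hw0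

open Polynomial in
-- The case `q = 4`, where six roots would be one too many. In characteristic 2 the square of the
-- equation has only four terms; multiplied by `D w` it contains `D³ w^15 = D³` and `D B² w^7`, and
-- the latter is reduced by the equation itself. The result has degree at most 5 and linear
-- coefficient `D E² ≠ 0`.
theorem card_le_five_of_card_eq_sixteen (hF : Fintype.card F = 16) {A B D E : F} (hD : D ≠ 0)
    (hE : E ≠ 0) {S : Finset F} (hS0 : ∀ w ∈ S, w ≠ 0)
    (hS : ∀ w ∈ S, A * w ^ 2 + B * w ^ 3 + D * w ^ 7 + E = 0) : S.card ≤ 5 := by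
  obtain ⟨p, hp⟩ := CharP.exists F
  obtain ⟨n, hpp, hn⟩ := FiniteField.card F p
  have hp2 : p = 2 := by
    have : p ∣ 2 ^ 4 := by
      rw [show 2 ^ 4 = p ^ (n : ℕ) by rw [← hn, hF]; norm_num]; exact dvd_pow_self _ n.ne_zero
    exact (Nat.prime_dvd_prime_iff_eq hpp Nat.prime_two).1 (hpp.dvd_of_dvd_pow this)
  subst hp2
  have h2 : (2 : F) = 0 := CharP.ofNat_eq_zero F 2
  set r : F[X] := C (D * A ^ 2) * X ^ 5 + C (B ^ 3) * X ^ 3 + C (A * B ^ 2) * X ^ 2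
    + C (D * E ^ 2) * X + C (D ^ 3 + B ^ 2 * E) with hr
  have hr0 : r ≠ 0 := by
    intro h
    have : r.coeff 1 = D * E ^ 2 := by
      simp only [hr, coeff_add, coeff_C_mul, coeff_X_pow, coeff_X_one, coeff_C]
      norm_num
    rw [h, coeff_zero] at this
    exact mul_ne_zero hD (pow_ne_zero _ hE) this.symm
  refine card_root_set_le r hr0 (by rw [hr]; compute_degree) fun w hw => ?_
  have h1 := hS w hw
  have h15 : w ^ 15 = 1 := by
    have := FiniteField.pow_card_sub_one_eq_one w (hS0 w hw)
    rwa [hF] at this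
  simp only [hr, eval_add, eval_mul, eval_C, eval_pow, eval_X]
  linear_combination D * w * (A * w ^ 2 + B * w ^ 3 + D * w ^ 7 + E) * h1 + B ^ 2 * h1
    - D ^ 3 * h15
    - (D * w * (A * B * w ^ 5 + A * D * w ^ 9 + A * E * w ^ 2 + B * D * w ^ 10 + B * E * w ^ 3
      + D * E * w ^ 7) + D * B ^ 2 * w ^ 7) * h2

open Polynomial in
/-- At most `q + 1` nonzero elements satisfy `E w³ + A w^(q+1) + B w^(q+2) + D w^(2q+2) = 0`. -/
theorem card_zeros_le (hq : 4 ≤ q) (hF : Fintype.card F = q ^ 2) {A B D E : F}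
    (h0 : ¬ (A = 0 ∧ B = 0 ∧ D = 0 ∧ E = 0)) {S : Finset F} (hS0 : ∀ w ∈ S, w ≠ 0)
    (hS : ∀ w ∈ S, A * w ^ (q + 1) + B * w ^ (q + 2) + D * w ^ (2 * q + 2) + E * w ^ 3 = 0) :
    S.card ≤ q + 1 := by
  by_cases hE : E = 0
  · set r : F[X] := C A + C B * X + C D * X ^ (q + 1) with hr
    have hr0 : r ≠ 0 := by
      intro h
      have c0 : r.coeff 0 = A := by simp [hr, coeff_X_pow]
      have c1 : r.coeff 1 = B := by simp [hr, coeff_X_pow, coeff_C, show q ≠ 0 by omega]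
      have c2 : r.coeff (q + 1) = D := by simp [hr, coeff_C, show q ≠ 0 by omega]
      rw [h, coeff_zero] at c0 c1 c2
      exact h0 ⟨c0.symm, c1.symm, c2.symm, hE⟩
    refine card_root_set_le r hr0 (by rw [hr]; compute_degree!) fun w hw => ?_
    have h1 : w ^ (q + 1) * r.eval w = 0 := by
      rw [← hS w hw, hE]
      simp only [hr, eval_add, eval_mul, eval_C, eval_pow, eval_X]
      ring
    exact (mul_eq_zero.1 h1).resolve_left (pow_ne_zero _ (hS0 w hw))
  by_cases hD : D = 0
  · set r : F[X] := C E + C A * X ^ (q - 2) + C B * X ^ (q - 1) with hr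
    have hr0 : r ≠ 0 := by
      intro h
      have c0 : r.coeff 0 = E := by
        simp [hr, coeff_X_pow, show 0 ≠ q - 2 by omega, show 0 ≠ q - 1 by omega]
      rw [h, coeff_zero] at c0
      exact hE c0.symm
    refine card_root_set_le r hr0 (by rw [hr]; compute_degree!; omega) fun w hw => ?_
    have h1 : w ^ 3 * r.eval w = 0 := by
      rw [← hS w hw, hD]
      obtain ⟨s, rfl⟩ : ∃ s, q = s + 2 := ⟨q - 2, by omega⟩
      simp only [hr, eval_add, eval_mul, eval_C, eval_pow, eval_X,
        show s + 2 - 2 = s by omega, show s + 2 - 1 = s + 1 by omega]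
      ring
    exact (mul_eq_zero.1 h1).resolve_left (pow_ne_zero _ (hS0 w hw))
  rcases hq.eq_or_lt with rfl | hq5
  · refine card_le_five_of_card_eq_sixteen (hF.trans (by norm_num)) (A := A) (B := B) hD hE hS0
      fun w hw => ?_
    refine (mul_eq_zero.1 (?_ : w ^ 3 * _ = 0)).resolve_left (pow_ne_zero _ (hS0 w hw))
    rw [← hS w hw]; ring
  · refine (card_le_six_of_cubic hF (A := A) (B := B) hD hE hS0 fun w hw => ?_).trans (by omega)
    refine (mul_eq_zero.1 (?_ : w * _ = 0)).resolve_left (hS0 w hw)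
    rw [← hS w hw]; ring

end FiniteField

/-! ### Homogeneous forms and affine points -/

section Affine

variable {q : ℕ} {F : Type*} [Field F]

theorem aeval_smul_of_isHomogeneous {A : Type*} [CommRing A] [Algebra F A] {σ : Type*}
    {b : MvPolynomial σ F} {d : ℕ} (hb : b.IsHomogeneous d) (c : A) (x : σ → A) :
    MvPolynomial.aeval (c • x) b = c ^ d * MvPolynomial.aeval x b := by
  rw [MvPolynomial.aeval_def, MvPolynomial.aeval_def, MvPolynomial.eval₂_eq,
    MvPolynomial.eval₂_eq, Finset.mul_sum]
  refine Finset.sum_congr rfl fun m hm => ?_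
  have hd : m.degree = d := by
    rw [Finsupp.degree_eq_weight_one]; exact hb (MvPolynomial.mem_support_iff.1 hm)
  simp only [Pi.smul_apply, smul_eq_mul, mul_pow, Finset.prod_mul_distrib]
  rw [Finset.prod_pow_eq_pow_sum, ← Finsupp.degree_apply, hd]
  ring

theorem vanishes_mk_iff {b : MvPolynomial (Fin 3) F} {d : ℕ} (hb : b.IsHomogeneous d)
    {x : Fin 3 → AlgebraicClosure F} (hx : x ≠ 0) :
    Vanishes b (Projectivization.mk (AlgebraicClosure F) x hx) ↔ MvPolynomial.aeval x b = 0 := by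
  obtain ⟨c, hc⟩ := Projectivization.exists_smul_eq_mk_rep (AlgebraicClosure F) x hx
  rw [Vanishes, ← hc, Units.smul_def, aeval_smul_of_isHomogeneous hb, mul_eq_zero]
  simp

theorem hermitianForm_isHomogeneous (q : ℕ) (F : Type*) [Field F] :
    (hermitianForm q F).IsHomogeneous (q + 1) := by
  refine .sub (.add ?_ ?_) ?_
  · simpa using ((MvPolynomial.isHomogeneous_X F (1 : Fin 3)).pow q).mul
      (MvPolynomial.isHomogeneous_X F (2 : Fin 3))
  · simpa [add_comm] using (MvPolynomial.isHomogeneous_X F (1 : Fin 3)).mul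
      ((MvPolynomial.isHomogeneous_X F (2 : Fin 3)).pow q)
  · simpa using (MvPolynomial.isHomogeneous_X F (0 : Fin 3)).pow (q + 1)

/-- The coordinate function `x` in the coordinate ring. -/
noncomputable def ringX (q : ℕ) (F : Type*) [Field F] : CoordRing q F :=
  AdjoinRoot.root (affineEquation q F)

/-- The coordinate function `y` in the coordinate ring. -/
noncomputable def ringY (q : ℕ) (F : Type*) [Field F] : CoordRing q F :=
  AdjoinRoot.of (affineEquation q F) Polynomial.X

theorem ringX_pow (q : ℕ) (F : Type*) [Field F] :
    ringX q F ^ (q + 1) = ringY q F ^ q + ringY q F := by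
  have h := AdjoinRoot.mk_self (f := affineEquation q F)
  rw [affineEquation] at h
  simp only [map_sub, map_pow, AdjoinRoot.mk_X, AdjoinRoot.mk_C, map_add] at h
  exact sub_eq_zero.1 h

/-- The function `a(x, y, 1)` in the coordinate ring. -/
noncomputable def ringDehom (q : ℕ) {F : Type*} [Field F] :
    MvPolynomial (Fin 3) F →ₐ[F] CoordRing q F :=
  MvPolynomial.aeval ![ringX q F, ringY q F, 1]

theorem ringDehom_apply (a : MvPolynomial (Fin 3) F) :
    ringDehom q a = MvPolynomial.aeval ![ringX q F, ringY q F, 1] a := rfl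

theorem algebraMap_ringDehom (a : MvPolynomial (Fin 3) F) :
    algebraMap (CoordRing q F) (FunField q F) (ringDehom q a) = dehom q a := by
  rw [ringDehom, dehom, ← MvPolynomial.aeval_algebraMap_apply]
  congr 2
  ext i
  fin_cases i <;> simp [ringX, ringY, coordX, coordY]

theorem ringDehom_surjective : Function.Surjective (ringDehom q (F := F)) := by
  have hY : ∀ p : F[X], AdjoinRoot.of (affineEquation q F) p ∈ (ringDehom q (F := F)).range := by
    intro p
    induction p using Polynomial.induction_on' with
    | add p r hp hr => rw [map_add]; exact add_mem hp hr
    | monomial n a =>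
      refine ⟨MvPolynomial.C a * MvPolynomial.X 1 ^ n, ?_⟩
      change ringDehom q (_ : MvPolynomial (Fin 3) F) = _
      rw [← Polynomial.C_mul_X_pow_eq_monomial]
      simp only [map_mul, map_pow, ringDehom_apply, MvPolynomial.aeval_X, MvPolynomial.aeval_C]
      rfl
  intro r
  change r ∈ (ringDehom q (F := F)).range
  induction r using AdjoinRoot.induction_on with
  | ih p =>
    induction p using Polynomial.induction_on' with
    | add p r hp hr => rw [map_add]; exact add_mem hp hr
    | monomial n a =>
      rw [← Polynomial.C_mul_X_pow_eq_monomial, map_mul, map_pow, AdjoinRoot.mk_C, AdjoinRoot.mk_X]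
      have hX : AdjoinRoot.root (affineEquation q F) ∈ (ringDehom q (F := F)).range :=
        ⟨MvPolynomial.X 0, by
          change ringDehom q (_ : MvPolynomial (Fin 3) F) = _
          simp [ringDehom_apply, ringX]⟩
      exact mul_mem (hY a) (pow_mem hX n)

/-- Every function in the coordinate ring is `a(x, y, 1)` with `a` homogeneous of any large enough
degree. -/
theorem exists_homogeneous (r : CoordRing q F) : ∃ D : ℕ, ∀ d ≥ D,
    ∃ a : MvPolynomial (Fin 3) F, a.IsHomogeneous d ∧ ringDehom q a = r := by
  obtain ⟨p, rfl⟩ := ringDehom_surjective r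
  refine ⟨p.totalDegree, fun d hd => ⟨∑ i ∈ Finset.range (p.totalDegree + 1),
    MvPolynomial.homogeneousComponent i p * MvPolynomial.X 2 ^ (d - i),
    MvPolynomial.IsHomogeneous.sum _ _ _ fun i hi => ?_, ?_⟩⟩
  · have hi' : i ≤ d := by have := Finset.mem_range.1 hi; omega
    have := (MvPolynomial.homogeneousComponent_isHomogeneous i p).mul
      ((MvPolynomial.isHomogeneous_X F (2 : Fin 3)).pow (d - i))
    rwa [one_mul, Nat.add_sub_cancel' hi'] at this
  · rw [map_sum]
    conv_rhs => rw [← MvPolynomial.sum_homogeneousComponent p, map_sum]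
    refine Finset.sum_congr rfl fun i _ => ?_
    rw [map_mul, map_pow, ringDehom_apply (MvPolynomial.X 2)]
    simp

theorem vec_one_ne_zero {K : Type*} [Field K] (a b : K) : ![a, b, 1] ≠ 0 :=
  fun h => by simpa using congrFun h 2

/-- The point of the curve given by a homomorphism from the coordinate ring. -/
noncomputable def pointOf (ψ : CoordRing q F →ₐ[F] AlgebraicClosure F) : Point q F :=
  ⟨Projectivization.mk _ ![ψ (ringX q F), ψ (ringY q F), 1] (vec_one_ne_zero _ _), by
    rw [vanishes_mk_iff (hermitianForm_isHomogeneous q F), hermitianForm]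
    have h := congrArg ψ (ringX_pow q F)
    simp only [map_add, map_pow] at h
    simp [h]⟩

theorem algHom_ringDehom (ψ : CoordRing q F →ₐ[F] AlgebraicClosure F)
    (a : MvPolynomial (Fin 3) F) :
    ψ (ringDehom q a) = MvPolynomial.aeval ![ψ (ringX q F), ψ (ringY q F), 1] a := by
  rw [ringDehom_apply, ← AlgHom.comp_apply, MvPolynomial.comp_aeval]
  congr 2
  ext i
  fin_cases i <;> simp

theorem vanishes_pointOf_iff (ψ : CoordRing q F →ₐ[F] AlgebraicClosure F)
    {a : MvPolynomial (Fin 3) F} {d : ℕ} (ha : a.IsHomogeneous d) :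
    Vanishes a (pointOf ψ).1 ↔ ψ (ringDehom q a) = 0 := by
  rw [algHom_ringDehom, pointOf, vanishes_mk_iff ha]

/-- At affine points the quotients of forms of equal degree can be replaced by quotients of ring
elements: numerator and denominator are homogenised to a common degree with powers of `X₃`. -/
theorem mem_localRing_pointOf_iff (ψ : CoordRing q F →ₐ[F] AlgebraicClosure F)
    (f : FunField q F) : f ∈ localRing (pointOf ψ) ↔ ∃ r s : CoordRing q F, ψ s ≠ 0 ∧
      f * algebraMap _ _ s = algebraMap _ _ r := by
  constructor
  · rintro ⟨d, a, b, ha, hb, hbP, h⟩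
    refine ⟨ringDehom q a, ringDehom q b, ?_, ?_⟩
    · rwa [Ne, ← vanishes_pointOf_iff ψ hb]
    · rw [algebraMap_ringDehom, algebraMap_ringDehom, h]
  · rintro ⟨r, s, hs, h⟩
    obtain ⟨D, hD⟩ := exists_homogeneous r
    obtain ⟨E, hE⟩ := exists_homogeneous s
    obtain ⟨a, ha, rfl⟩ := hD (max D E) (le_max_left _ _)
    obtain ⟨b, hb, rfl⟩ := hE (max D E) (le_max_right _ _)
    refine ⟨_, a, b, ha, hb, ?_, ?_⟩
    · rwa [vanishes_pointOf_iff ψ hb]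
    · rw [← algebraMap_ringDehom, ← algebraMap_ringDehom, h]

theorem mem_maxIdeal_pointOf_iff (ψ : CoordRing q F →ₐ[F] AlgebraicClosure F)
    (f : FunField q F) : f ∈ maxIdeal (pointOf ψ) ↔ ∃ r s : CoordRing q F, ψ s ≠ 0 ∧ ψ r = 0 ∧
      f * algebraMap _ _ s = algebraMap _ _ r := by
  constructor
  · rintro ⟨d, a, b, ha, hb, hbP, haP, h⟩
    refine ⟨ringDehom q a, ringDehom q b, ?_, ?_, ?_⟩
    · rwa [Ne, ← vanishes_pointOf_iff ψ hb]
    · rwa [← vanishes_pointOf_iff ψ ha]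
    · rw [algebraMap_ringDehom, algebraMap_ringDehom, h]
  · rintro ⟨r, s, hs, hr, h⟩
    obtain ⟨D, hD⟩ := exists_homogeneous r
    obtain ⟨E, hE⟩ := exists_homogeneous s
    obtain ⟨a, ha, rfl⟩ := hD (max D E) (le_max_left _ _)
    obtain ⟨b, hb, rfl⟩ := hE (max D E) (le_max_right _ _)
    refine ⟨_, a, b, ha, hb, ?_, ?_, ?_⟩
    · rwa [vanishes_pointOf_iff ψ hb]
    · rwa [vanishes_pointOf_iff ψ ha]
    · rw [← algebraMap_ringDehom, ← algebraMap_ringDehom, h]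

theorem algebraMap_mem_localRing (ψ : CoordRing q F →ₐ[F] AlgebraicClosure F)
    (r : CoordRing q F) : algebraMap _ (FunField q F) r ∈ localRing (pointOf ψ) :=
  (mem_localRing_pointOf_iff ψ _).2 ⟨r, 1, by simp, by simp⟩

/-- Evaluation of functions at an affine point of the curve over an extension of `F`. -/
noncomputable def evalHom {K : Type*} [Field K] [Algebra F K] (a b : K)
    (h : b ^ q + b = a ^ (q + 1)) : CoordRing q F →ₐ[F] K :=
  AdjoinRoot.liftAlgHom _ (Polynomial.aeval b) a (by
    simp only [affineEquation, Polynomial.eval₂_sub, Polynomial.eval₂_X_pow, Polynomial.eval₂_C]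
    simp [h])

theorem evalHom_ringX {K : Type*} [Field K] [Algebra F K] {a b : K}
    (h : b ^ q + b = a ^ (q + 1)) : evalHom a b h (ringX q F) = a := by
  simp [evalHom, ringX]

theorem evalHom_ringY {K : Type*} [Field K] [Algebra F K] {a b : K}
    (h : b ^ q + b = a ^ (q + 1)) : evalHom a b h (ringY q F) = b := by
  simp [evalHom, ringY]

theorem affinePoint_eq_pointOf {a b : F} (h : b ^ q + b = a ^ (q + 1)) :
    affinePoint q a b h = pointOf ((Algebra.ofId F (AlgebraicClosure F)).comp (evalHom a b h)) := by
  apply Subtype.ext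
  simp only [affinePoint, affineProj, pointOf, AlgHom.comp_apply, evalHom_ringX, evalHom_ringY]
  rfl

theorem affinePoint_inj {a b a' b' : F} {h : b ^ q + b = a ^ (q + 1)}
    {h' : b' ^ q + b' = a' ^ (q + 1)} (hP : affinePoint q a b h = affinePoint q a' b' h') :
    a = a' ∧ b = b' := by
  have := congrArg Subtype.val hP
  simp only [affinePoint, affineProj] at this
  rw [Projectivization.mk_eq_mk_iff'] at this
  obtain ⟨c, hc⟩ := this
  have h2 : c = 1 := by simpa using congrFun hc 2
  subst h2
  have h0 := congrFun hc 0
  have h1 := congrFun hc 1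
  simp only [one_smul, Matrix.cons_val_zero, Matrix.cons_val_one] at h0 h1
  exact ⟨(algebraMap F _).injective h0.symm, (algebraMap F _).injective h1.symm⟩

theorem affinePoint_vanishes_iff {a b : F} (h : b ^ q + b = a ^ (q + 1))
    {V : MvPolynomial (Fin 3) F} {d : ℕ} (hV : V.IsHomogeneous d) :
    Vanishes V (affinePoint q a b h).1 ↔ MvPolynomial.aeval ![a, b, 1] V = 0 := by
  have : ![algebraMap F (AlgebraicClosure F) a, algebraMap F (AlgebraicClosure F) b, 1] =
      fun i => algebraMap F (AlgebraicClosure F) (![a, b, 1] i) := by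
    ext i; fin_cases i <;> simp
  rw [affinePoint]
  unfold affineProj
  rw [vanishes_mk_iff hV, this]
  rw [show (fun i => algebraMap F (AlgebraicClosure F) (![a, b, 1] i)) =
    algebraMap F (AlgebraicClosure F) ∘ ![a, b, 1] from rfl]
  rw [MvPolynomial.aeval_algebraMap_apply]
  simp

/-- The point `(0 : 1 : 0)` of the curve. -/
noncomputable def infPoint (q : ℕ) (hq : q ≠ 0) (F : Type*) [Field F] : Point q F :=
  ⟨Projectivization.mk _ ![0, 1, 0] (fun h => by simpa using congrFun h 1), by
    rw [vanishes_mk_iff (hermitianForm_isHomogeneous q F), hermitianForm]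
    simp [hq]⟩

theorem pointOf_ne_infPoint (hq : q ≠ 0) (ψ : CoordRing q F →ₐ[F] AlgebraicClosure F) :
    pointOf ψ ≠ infPoint q hq F := by
  intro h
  have := congrArg Subtype.val h
  simp only [pointOf, infPoint] at this
  rw [Projectivization.mk_eq_mk_iff'] at this
  obtain ⟨c, hc⟩ := this
  simpa using congrFun hc 2

/-- On the line `X₃ = 0` the equation of the curve forces `X₁ = 0`. -/
theorem eq_infPoint_or_pointOf (hq : q ≠ 0) (P : Point q F) :
    P = infPoint q hq F ∨ ∃ ψ : CoordRing q F →ₐ[F] AlgebraicClosure F, P = pointOf ψ := by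
  obtain ⟨P, hP⟩ := P
  have h : MvPolynomial.aeval P.rep (hermitianForm q F) = 0 := hP
  simp only [hermitianForm, map_sub, map_add, map_mul, map_pow, MvPolynomial.aeval_X] at h
  by_cases h2 : P.rep 2 = 0
  · left
    have h0 : P.rep 0 = 0 := by
      rw [h2] at h; simpa [hq] using h
    apply Subtype.ext
    refine P.mk_rep.symm.trans ?_
    simp only [infPoint]
    rw [Projectivization.mk_eq_mk_iff']
    refine ⟨P.rep 1, ?_⟩
    ext i
    fin_cases i <;> simp [h0, h2]
  · right
    refine ⟨evalHom (P.rep 0 / P.rep 2) (P.rep 1 / P.rep 2) ?_, ?_⟩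
    · rw [div_pow, div_pow]
      field_simp
      linear_combination P.rep 2 * P.rep 2 ^ q * h
    · apply Subtype.ext
      refine P.mk_rep.symm.trans ?_
      simp only [pointOf, evalHom_ringX, evalHom_ringY]
      rw [Projectivization.mk_eq_mk_iff']
      refine ⟨P.rep 2, ?_⟩
      ext i
      fin_cases i <;> simp <;> field_simp

end Affine

/-! ### Functions regular at all affine points -/

section Regular

variable {q : ℕ} {F : Type*} [Field F]

/-- The weak Nullstellensatz: the residue field at a maximal ideal containing `I` is finite over
`F`, hence embeds in the algebraic closure. -/
theorem exists_algHom_of_ne_top (I : Ideal (CoordRing q F)) (hI : I ≠ ⊤) :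
    ∃ ψ : CoordRing q F →ₐ[F] AlgebraicClosure F, ∀ r ∈ I, ψ r = 0 := by
  obtain ⟨M, hM, hIM⟩ := I.exists_le_maximal hI
  let _ := Ideal.Quotient.field M
  have : Algebra.FiniteType F (CoordRing q F) :=
    .of_surjective (ringDehom q (F := F)) ringDehom_surjective
  have : Algebra.FiniteType F (CoordRing q F ⧸ M) :=
    .of_surjective (Ideal.Quotient.mkₐ F M) (Ideal.Quotient.mkₐ_surjective F M)
  have : Module.Finite F (CoordRing q F ⧸ M) := finite_of_finite_type_of_isJacobsonRing _ _
  refine ⟨(IsAlgClosed.lift (M := AlgebraicClosure F) (R := F) (S := CoordRing q F ⧸ M)).comp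
    (Ideal.Quotient.mkₐ F M), fun r hr => ?_⟩
  rw [AlgHom.comp_apply, Ideal.Quotient.mkₐ_eq_mk, Ideal.Quotient.eq_zero_iff_mem.2 (hIM hr),
    map_zero]

/-- A function that is regular at all affine points lies in the coordinate ring. -/
theorem exists_eq_algebraMap_of_forall_mem_localRing (f : FunField q F)
    (hf : ∀ ψ : CoordRing q F →ₐ[F] AlgebraicClosure F, f ∈ localRing (pointOf ψ)) :
    ∃ r : CoordRing q F, algebraMap _ _ r = f := by
  -- The ideal of denominators of `f`. If it were proper, it would vanish at some affine point,
  -- although regularity there supplies a denominator that does not.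
  let I : Ideal (CoordRing q F) :=
    { carrier := {s | ∃ r, f * algebraMap _ _ s = algebraMap (CoordRing q F) (FunField q F) r}
      zero_mem' := ⟨0, by simp⟩
      add_mem' := by
        rintro s t ⟨r, hr⟩ ⟨r', hr'⟩
        exact ⟨r + r', by rw [map_add, mul_add, hr, hr', map_add]⟩
      smul_mem' := by
        rintro c s ⟨r, hr⟩
        exact ⟨c * r, by rw [smul_eq_mul, map_mul, mul_left_comm, hr, map_mul]⟩ }
  by_cases hI : I = ⊤
  · obtain ⟨r, hr⟩ : (1 : CoordRing q F) ∈ I := hI ▸ Submodule.mem_top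
    exact ⟨r, by rw [← hr, map_one, mul_one]⟩
  · obtain ⟨ψ, hψ⟩ := exists_algHom_of_ne_top I hI
    obtain ⟨r, s, hs, h⟩ := (mem_localRing_pointOf_iff ψ f).1 (hf ψ)
    exact (hs (hψ s ⟨r, h⟩)).elim

end Regular

/-! ### Normal forms in the coordinate ring -/

section NormalForm

variable {q : ℕ} {F : Type*} [Field F]

theorem affineEquation_monic (q : ℕ) (F : Type*) [Field F] : (affineEquation q F).Monic :=
  Polynomial.monic_X_pow_sub_C _ (Nat.succ_ne_zero q)

theorem affineEquation_natDegree (q : ℕ) (F : Type*) [Field F] :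
    (affineEquation q F).natDegree = q + 1 :=
  Polynomial.natDegree_X_pow_sub_C

/-- The reduced polynomial, of degree at most `q` in `x`, that represents a function. -/
noncomputable def normalForm (r : CoordRing q F) : F[X][X] :=
  AdjoinRoot.modByMonicHom (affineEquation_monic q F) r

theorem mk_normalForm (r : CoordRing q F) :
    AdjoinRoot.mk (affineEquation q F) (normalForm r) = r :=
  AdjoinRoot.mk_leftInverse (affineEquation_monic q F) r

theorem normalForm_degree_lt (r : CoordRing q F) : (normalForm r).degree < (q + 1 : ℕ) := by
  induction r using AdjoinRoot.induction_on with
  | ih p =>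
    rw [normalForm, AdjoinRoot.modByMonicHom_mk]
    refine (Polynomial.degree_modByMonic_lt p (affineEquation_monic q F)).trans_eq ?_
    rw [Polynomial.degree_eq_natDegree (affineEquation_monic q F).ne_zero,
      affineEquation_natDegree]

theorem normalForm_natDegree_lt (r : CoordRing q F) : (normalForm r).natDegree < q + 1 := by
  by_cases h : normalForm r = 0
  · rw [h, Polynomial.natDegree_zero]; omega
  · exact (Polynomial.natDegree_lt_iff_degree_lt h).2 (normalForm_degree_lt r)

theorem normalForm_mk {p : F[X][X]} (hp : p.degree < (q + 1 : ℕ)) :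
    normalForm (AdjoinRoot.mk (affineEquation q F) p) = p := by
  rw [normalForm, AdjoinRoot.modByMonicHom_mk,
    Polynomial.modByMonic_eq_self_iff (affineEquation_monic q F),
    Polynomial.degree_eq_natDegree (affineEquation_monic q F).ne_zero, affineEquation_natDegree]
  exact hp

/-- The coefficient of `x^i y^j` in the normal form. -/
noncomputable def coef (i j : ℕ) : CoordRing q F →ₗ[F] F :=
  (Polynomial.lcoeff F j).comp (((Polynomial.lcoeff F[X] i).comp
    (AdjoinRoot.modByMonicHom (affineEquation_monic q F))).restrictScalars F)

theorem coef_apply (i j : ℕ) (r : CoordRing q F) :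
    coef i j r = ((normalForm r).coeff i).coeff j := rfl

theorem mk_monomial (i j : ℕ) : AdjoinRoot.mk (affineEquation q F)
    (Polynomial.C (Polynomial.X ^ j) * Polynomial.X ^ i) = ringX q F ^ i * ringY q F ^ j := by
  rw [map_mul, AdjoinRoot.mk_C, map_pow, map_pow, AdjoinRoot.mk_X, mul_comm]
  rfl

theorem coef_monomial {i : ℕ} (hi : i ≤ q) (j i' j' : ℕ) :
    coef i' j' (ringX q F ^ i * ringY q F ^ j) = if i' = i ∧ j' = j then 1 else 0 := by
  rw [← mk_monomial, coef_apply, normalForm_mk]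
  · rw [Polynomial.coeff_C_mul, Polynomial.coeff_X_pow]
    by_cases h : i' = i <;> simp [h, Polynomial.coeff_X_pow]
  · refine (Polynomial.degree_C_mul_X_pow_le _ _).trans_lt ?_
    exact_mod_cast Nat.lt_succ_of_le hi

/-- Only monomials of weight at most that of `x^i y^j` occur in its normal form, where `x` has
weight `q` and `y` has weight `q + 1`. -/
theorem weight_le_of_coef_ne_zero (hq : 1 ≤ q) (i j i' j' : ℕ)
    (h : coef i' j' (ringX q F ^ i * ringY q F ^ j) ≠ 0) :
    q * i' + (q + 1) * j' ≤ q * i + (q + 1) * j := by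
  induction i using Nat.strong_induction_on generalizing j with
  | _ i ih =>
    rcases le_or_gt i q with hi | hi
    · rw [coef_monomial hi] at h
      have := (ite_ne_right_iff.1 h).1
      rw [this.1, this.2]
    · obtain ⟨k, rfl⟩ := Nat.exists_eq_add_of_lt hi
      have key : ringX q F ^ (q + k + 1) * ringY q F ^ j =
          ringX q F ^ k * ringY q F ^ (j + q) + ringX q F ^ k * ringY q F ^ (j + 1) := by
        rw [show q + k + 1 = k + (q + 1) by ring, pow_add, ringX_pow]; ring
      rw [key, map_add] at h
      have h' : coef i' j' (ringX q F ^ k * ringY q F ^ (j + q)) ≠ 0 ∨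
          coef i' j' (ringX q F ^ k * ringY q F ^ (j + 1)) ≠ 0 := by
        by_contra! hc
        exact h (by rw [hc.1, hc.2, add_zero])
      -- Replacing `x^(q+1)` by `y^q + y` keeps the weight `q (q + 1)` in the term `y^q` and does
      -- not raise it in the term `y`.
      rcases h' with h' | h'
      · refine (ih k (by omega) _ h').trans (le_of_eq ?_)
        ring
      · refine (ih k (by omega) _ h').trans ?_
        nlinarith

theorem eq_sum_coef (r : CoordRing q F) : r = ∑ i ∈ Finset.range (q + 1),
    ∑ j ∈ ((normalForm r).coeff i).support, coef i j r • (ringX q F ^ i * ringY q F ^ j) := by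
  conv_lhs => rw [← mk_normalForm r, Polynomial.as_sum_range' (normalForm r) (q + 1)
    (normalForm_natDegree_lt r), map_sum]
  refine Finset.sum_congr rfl fun i _ => ?_
  rw [← Polynomial.C_mul_X_pow_eq_monomial, map_mul]
  conv_lhs => rw [((normalForm r).coeff i).as_sum_support]
  rw [map_sum, map_sum, Finset.sum_mul]
  refine Finset.sum_congr rfl fun j _ => ?_
  rw [← mk_monomial, map_mul, ← smul_mul_assoc, coef_apply]
  congr 1
  rw [AdjoinRoot.mk_C, AdjoinRoot.mk_C, ← Polynomial.C_mul_X_pow_eq_monomial, map_mul,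
    Algebra.smul_def]
  rfl

end NormalForm

/-! ### The filtration by the pole order at infinity -/

section Weight

variable {q : ℕ} {F : Type*} [Field F]

/-- The span of the monomials `x^i y^j` of weight `q i + (q + 1) j` less than `n`. -/
noncomputable def weightLT (q : ℕ) (F : Type*) [Field F] (n : ℕ) : Submodule F (CoordRing q F) :=
  Submodule.span F {r | ∃ i j : ℕ, q * i + (q + 1) * j < n ∧ ringX q F ^ i * ringY q F ^ j = r}

theorem monomial_mem_weightLT {i j n : ℕ} (h : q * i + (q + 1) * j < n) :
    ringX q F ^ i * ringY q F ^ j ∈ weightLT q F n :=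
  Submodule.subset_span ⟨i, j, h, rfl⟩

theorem weightLT_mono {m n : ℕ} (h : m ≤ n) : weightLT q F m ≤ weightLT q F n :=
  Submodule.span_mono fun _ ⟨i, j, hij, hr⟩ => ⟨i, j, hij.trans_le h, hr⟩

theorem mul_mem_weightLT {m n : ℕ} {r s : CoordRing q F} (hr : r ∈ weightLT q F (m + 1))
    (hs : s ∈ weightLT q F n) : r * s ∈ weightLT q F (m + n) := by
  have h := Submodule.mul_mem_mul hr hs
  rw [weightLT, weightLT, Submodule.span_mul_span] at h
  refine Submodule.span_mono ?_ h
  rintro _ ⟨_, ⟨i, j, hij, rfl⟩, _, ⟨i', j', hij', rfl⟩, rfl⟩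
  exact ⟨i + i', j + j', by nlinarith, by simp only [pow_add]; ring⟩

/-- The span is over all monomials, including those with `i > q`; since reduction does not raise
weights, membership can be read off the normal form. -/
theorem mem_weightLT_iff (hq : 1 ≤ q) {n : ℕ} {r : CoordRing q F} : r ∈ weightLT q F n ↔
    ∀ i j : ℕ, n ≤ q * i + (q + 1) * j → coef i j r = 0 := by
  constructor
  · intro h i j hij
    induction h using Submodule.span_induction with
    | mem r hr =>
      obtain ⟨i', j', hlt, rfl⟩ := hr
      by_contra hc
      have := weight_le_of_coef_ne_zero hq _ _ _ _ hc
      omega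
    | zero => exact map_zero _
    | add r s _ _ hr hs => rw [map_add, hr, hs, add_zero]
    | smul c r _ hr => rw [map_smul, hr, smul_zero]
  · intro h
    rw [eq_sum_coef r]
    refine Submodule.sum_mem _ fun i _ => Submodule.sum_mem _ fun j _ => ?_
    rcases lt_or_ge (q * i + (q + 1) * j) n with hij | hij
    · exact Submodule.smul_mem _ _ (monomial_mem_weightLT hij)
    · rw [h i j hij, zero_smul]; exact Submodule.zero_mem _

theorem exists_mem_weightLT (r : CoordRing q F) : ∃ n, r ∈ weightLT q F n := by
  rw [eq_sum_coef r]
  set n := ∑ i ∈ Finset.range (q + 1), ∑ j ∈ ((normalForm r).coeff i).support,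
    (q * i + (q + 1) * j) with hn
  refine ⟨n + 1, Submodule.sum_mem _ fun i hi => Submodule.sum_mem _ fun j hj =>
    Submodule.smul_mem _ _ (monomial_mem_weightLT (Nat.lt_succ_of_le ?_))⟩
  exact (Finset.single_le_sum (f := fun j => q * i + (q + 1) * j)
    (fun _ _ => Nat.zero_le _) hj).trans
    (Finset.single_le_sum (f := fun i => ∑ j ∈ ((normalForm r).coeff i).support,
      (q * i + (q + 1) * j)) (fun _ _ => Nat.zero_le _) hi)

/-- Multiplication by `y^d` leaves the degree in `x` unchanged, so no reduction takes place and the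
coefficients are merely shifted. -/
theorem coef_mul_ringY_pow (i j d : ℕ) (r : CoordRing q F) :
    coef i (j + d) (r * ringY q F ^ d) = coef i j r := by
  have h : r * ringY q F ^ d = AdjoinRoot.mk (affineEquation q F)
      (Polynomial.C (Polynomial.X ^ d) * normalForm r) := by
    rw [map_mul, mk_normalForm, AdjoinRoot.mk_C, map_pow, mul_comm]; rfl
  rw [h, coef_apply, normalForm_mk, coef_apply, Polynomial.coeff_C_mul, Polynomial.coeff_X_pow_mul]
  refine (Polynomial.degree_mul_le _ _).trans_lt ?_
  refine (add_le_add_left Polynomial.degree_C_le _).trans_lt ?_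
  rw [zero_add]
  exact normalForm_degree_lt r

/-- If `s` has leading term `y^d`, then multiplication by `s` raises weights by `(q + 1) d`. -/
theorem mem_weightLT_of_mul_mem (hq : 1 ≤ q) {d N : ℕ} {c : F} (hc : c ≠ 0)
    {r s : CoordRing q F} (hs : s - c • ringY q F ^ d ∈ weightLT q F ((q + 1) * d))
    (hrs : r * s ∈ weightLT q F (N + (q + 1) * d)) : r ∈ weightLT q F N := by
  obtain ⟨n, hn⟩ := exists_mem_weightLT r
  -- Some weight bound holds for `r`; it is lowered to `N` one unit at a time.
  suffices ∀ k, r ∈ weightLT q F (N + k) → r ∈ weightLT q F N from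
    this n (weightLT_mono (by omega) hn)
  intro k
  induction k with
  | zero => exact id
  | succ k ih =>
    intro hr
    refine ih ((mem_weightLT_iff hq).2 fun i j hij => ?_)
    -- Here `c r y^d = r s - r (s - c y^d)`, and both terms have weight below `N + k + (q + 1) d`.
    have h1 : c • (r * ringY q F ^ d) ∈ weightLT q F (N + k + (q + 1) * d) := by
      have := Submodule.sub_mem _ (weightLT_mono (by omega) hrs)
        (mul_mem_weightLT (m := N + k) hr hs)
      rwa [mul_sub, sub_sub_cancel, mul_smul_comm] at this
    have h2 := (mem_weightLT_iff hq).1 h1 i (j + d) (by nlinarith)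
    rw [map_smul, coef_mul_ringY_pow, smul_eq_mul] at h2
    exact (mul_eq_zero.1 h2).resolve_left hc

theorem ringDehom_eq_sum (b : MvPolynomial (Fin 3) F) : ringDehom q b =
    ∑ m ∈ b.support, b.coeff m • (ringX q F ^ m 0 * ringY q F ^ m 1) := by
  rw [ringDehom_apply, MvPolynomial.aeval_def, MvPolynomial.eval₂_eq']
  refine Finset.sum_congr rfl fun m _ => ?_
  simp [Fin.prod_univ_three, Algebra.smul_def]

theorem ringDehom_mem_weightLT {b : MvPolynomial (Fin 3) F} {d : ℕ} (hb : b.IsHomogeneous d) :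
    ringDehom q b ∈ weightLT q F ((q + 1) * d + 1) := by
  rw [ringDehom_eq_sum]
  refine Submodule.sum_mem _ fun m hm => Submodule.smul_mem _ _ (monomial_mem_weightLT ?_)
  have hd : m.degree = d := by
    rw [Finsupp.degree_eq_weight_one]; exact hb (MvPolynomial.mem_support_iff.1 hm)
  rw [Finsupp.degree_eq_sum, Fin.sum_univ_three] at hd
  nlinarith [Nat.zero_le (m 2), Nat.zero_le (m 0), mul_nonneg (Nat.zero_le q) (Nat.zero_le (m 2))]

/-- Among the monomials of degree `d` only `X₂^d` reaches the weight `(q + 1) d`, and its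
coefficient is the value of the form at `(0, 1, 0)`. -/
theorem ringDehom_sub_mem_weightLT {b : MvPolynomial (Fin 3) F} {d : ℕ} (hb : b.IsHomogeneous d) :
    ringDehom q b - (MvPolynomial.aeval ![0, 1, 0] b : F) • ringY q F ^ d ∈
      weightLT q F ((q + 1) * d) := by
  rw [ringDehom_eq_sum, MvPolynomial.aeval_def, MvPolynomial.eval₂_eq', Finset.sum_smul,
    ← Finset.sum_sub_distrib]
  refine Submodule.sum_mem _ fun m hm => ?_
  have hd : m.degree = d := by
    rw [Finsupp.degree_eq_weight_one]; exact hb (MvPolynomial.mem_support_iff.1 hm)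
  rw [Finsupp.degree_eq_sum, Fin.sum_univ_three] at hd
  simp only [Fin.prod_univ_three, Algebra.algebraMap_self, RingHom.id_apply, Matrix.cons_val_zero,
    Matrix.cons_val_one, Matrix.cons_val]
  by_cases h : m 0 = 0 ∧ m 2 = 0
  · rw [h.1, h.2, show m 1 = d by omega]
    simp
  · have h0 : (0 : F) ^ m 0 * 1 ^ m 1 * 0 ^ m 2 = 0 := by
      by_cases h0 : m 0 = 0
      · rw [zero_pow (n := m 2) fun h2 => h ⟨h0, h2⟩, mul_zero]
      · rw [zero_pow h0, zero_mul, zero_mul]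
    rw [h0, mul_zero, zero_smul, sub_zero]
    refine Submodule.smul_mem _ _ (monomial_mem_weightLT ?_)
    rw [← hd]
    have : 1 ≤ m 0 + m 2 := by omega
    nlinarith [mul_nonneg (Nat.zero_le q) (Nat.zero_le (m 2))]

end Weight

/-! ### The Riemann–Roch space -/

section RiemannRoch

variable {q : ℕ} {F : Type*} [Field F]

theorem coordX_eq : coordX q F = algebraMap (CoordRing q F) (FunField q F) (ringX q F) := rfl

/-- If `r / x^n` is regular at the origin, then no `x^i` with `i < n` occurs in `r`. -/
theorem coef_eq_zero_of_mul_eq {n : ℕ} (hn : n ≤ q + 1) (hq : q ≠ 0) {r s t : CoordRing q F}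
    (hs : coef 0 0 s ≠ 0) (h : r * s = ringX q F ^ n * t) {i : ℕ} (hi : i < n) :
    coef i 0 r = 0 := by
  -- Setting `y = 0` turns the affine equation into `X^(q+1)`. Divisibility by `X^n` therefore
  -- survives for `n ≤ q + 1`, and the image of `s` is prime to `X`.
  let φ : F[X][X] →+* F[X] := Polynomial.mapRingHom (Polynomial.evalRingHom 0)
  have hφ : ∀ (k : ℕ) (z : CoordRing q F), (φ (normalForm z)).coeff k = coef k 0 z := fun k z => by
    simp [φ, coef_apply, Polynomial.coeff_zero_eq_eval_zero]
  have hdvd : affineEquation q F ∣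
      normalForm r * normalForm s - Polynomial.X ^ n * normalForm t := by
    rw [← AdjoinRoot.mk_eq_zero, map_sub, map_mul, map_mul, map_pow, AdjoinRoot.mk_X,
      mk_normalForm, mk_normalForm, mk_normalForm, h, ringX, sub_self]
  have hφe : φ (affineEquation q F) = Polynomial.X ^ (q + 1) := by
    simp [φ, affineEquation, hq]
  have h1 := map_dvd φ hdvd
  rw [hφe, map_sub, map_mul, map_mul, map_pow, show φ Polynomial.X = Polynomial.X by simp [φ]] at h1
  have h2 : Polynomial.X ^ n ∣ φ (normalForm r) * φ (normalForm s) :=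
    (dvd_sub_left (Dvd.intro _ rfl)).1 ((pow_dvd_pow _ hn).trans h1)
  have h3 : Polynomial.X ^ n ∣ φ (normalForm r) := by
    refine Polynomial.prime_X.pow_dvd_of_dvd_mul_right n (fun hX => hs ?_) h2
    rw [← hφ, Polynomial.X_dvd_iff.1 hX]
  rw [← hφ]
  exact Polynomial.X_pow_dvd_iff.1 h3 i hi

theorem evalHom_zero_eq_coef {K : Type*} [Field K] [Algebra F K]
    (h : (0 : K) ^ q + 0 = 0 ^ (q + 1)) (s : CoordRing q F) :
    evalHom 0 0 h s = algebraMap F K (coef 0 0 s) := by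
  conv_lhs => rw [← mk_normalForm s]
  rw [evalHom, AdjoinRoot.liftAlgHom_mk, coef_apply, Polynomial.eval₂_at_zero]
  simp [Polynomial.aeval_def, Polynomial.eval₂_at_zero]

theorem mem_ordGE_zero {P : Point q F} {f : FunField q F} :
    f ∈ ordGE P 0 ↔ f ∈ localRing P := by
  change f ∈ maxIdeal P ^ 0 ↔ _
  rw [pow_zero, Submodule.mem_one]
  exact ⟨fun ⟨y, hy⟩ => hy ▸ y.2, fun h => ⟨⟨f, h⟩, rfl⟩⟩

theorem mem_ordGE_neg_three {P : Point q F} {f : FunField q F} :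
    f ∈ ordGE P (-((3 : ℕ) : ℤ)) ↔ ∀ g ∈ maxIdeal P ^ 3, f * g ∈ localRing P := by
  change f ∈ 1 / maxIdeal P ^ 3 ↔ _
  rw [Submodule.mem_div_iff_forall_mul_mem]
  refine forall₂_congr fun g _ => ?_
  rw [Submodule.mem_one]
  exact ⟨fun ⟨y, hy⟩ => hy ▸ y.2, fun h => ⟨⟨_, h⟩, rfl⟩⟩

variable [Fintype F] [DecidableEq F]

theorem divG_apply_affinePoint (m : ℕ) {b : F} (hb : b ^ q + b = 0) (hb0 : b ≠ 0)
    (h : b ^ q + b = 0 ^ (q + 1)) : divG q F m (affinePoint q 0 b h) = m := by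
  classical
  rw [divG, Finsupp.finsetSum_apply, Finset.sum_eq_single ⟨b, hb, hb0⟩]
  · simp
  · intro b' _ hne
    rw [Finsupp.single_apply, if_neg]
    intro hP
    exact hne (Subtype.ext (affinePoint_inj hP).2)
  · simp

theorem divG_apply_of_ne (m : ℕ) (P : Point q F) (hP : ∀ (b : F) (h : b ^ q + b = 0 ^ (q + 1)),
    b ≠ 0 → P ≠ affinePoint q 0 b h) : divG q F m P = 0 := by
  classical
  rw [divG, Finsupp.finsetSum_apply]
  refine Finset.sum_eq_zero fun b _ => ?_
  rw [Finsupp.single_apply, if_neg]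
  exact fun h => hP _ _ b.2.2 h.symm

/-- For `f` in `ℒ(3(P₂ + ⋯ + P_q))` the function `x³ f` is `y (a + b x + c y) + ε x³`. -/
theorem exists_of_mem_riemannRoch (hq : 4 ≤ q) {f : FunField q F}
    (hf : f ∈ riemannRoch (divG q F 3)) : ∃ a b c ε : F,
      f * coordX q F ^ 3 = algebraMap (CoordRing q F) (FunField q F)
        (a • ringY q F + b • (ringX q F * ringY q F) + c • ringY q F ^ 2 + ε • ringX q F ^ 3) := by
  have hq0 : q ≠ 0 := by omega
  have hord : ∀ P, f ∈ ordGE P (-(divG q F 3 P)) := by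
    simpa only [riemannRoch, Submodule.mem_iInf, Submodule.restrictScalars_mem] using hf
  have hreg : ∀ P : Point q F, (∀ (b : F) (h : b ^ q + b = 0 ^ (q + 1)),
      b ≠ 0 → P ≠ affinePoint q 0 b h) → f ∈ localRing P := fun P hP => by
    have := hord P
    rwa [divG_apply_of_ne 3 P hP, neg_zero, mem_ordGE_zero] at this
  -- At each `P_i` the function `x³` lies in the cube of the maximal ideal, so it absorbs the pole
  -- of `f`.
  obtain ⟨r, hr⟩ : ∃ r : CoordRing q F, algebraMap _ _ r = f * coordX q F ^ 3 := by
    refine exists_eq_algebraMap_of_forall_mem_localRing _ fun ψ => ?_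
    by_cases hP : ∀ (b : F) (h : b ^ q + b = 0 ^ (q + 1)), b ≠ 0 → pointOf ψ ≠ affinePoint q 0 b h
    · exact mul_mem (hreg _ hP) (pow_mem (algebraMap_mem_localRing ψ _) 3)
    · push Not at hP
      obtain ⟨b, h, hb0, hP⟩ := hP
      have := hord (pointOf ψ)
      rw [hP, divG_apply_affinePoint 3 (by rw [h, zero_pow (Nat.succ_ne_zero q)]) hb0,
        mem_ordGE_neg_three] at this
      rw [hP]
      refine this _ (Submodule.pow_mem_pow _ ?_ 3)
      rw [affinePoint_eq_pointOf, mem_maxIdeal_pointOf_iff]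
      exact ⟨ringX q F, 1, by simp, by simp [evalHom_ringX], by simp [coordX_eq]⟩
  have hinj : Function.Injective (algebraMap (CoordRing q F) (FunField q F)) :=
    IsFractionRing.injective _ _
  have horigin : ∀ i < 3, coef i 0 r = 0 := by
    intro i hi
    have h0 : (0 : F) ^ q + 0 = 0 ^ (q + 1) := by simp [hq0]
    have hmem : f ∈ localRing (affinePoint q 0 0 h0) := hreg _ fun b h hb hP =>
      hb (affinePoint_inj hP).2.symm
    rw [affinePoint_eq_pointOf, mem_localRing_pointOf_iff] at hmem
    obtain ⟨t, s, hs, hst⟩ := hmem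
    refine coef_eq_zero_of_mul_eq (s := s) (t := t) (n := 3) (by omega) hq0 ?_ (hinj ?_) hi
    · rw [AlgHom.comp_apply, evalHom_zero_eq_coef] at hs
      intro hc
      rw [hc] at hs
      simp at hs
    · rw [map_mul, map_mul, map_pow, hr, ← hst, ← coordX_eq]; ring
  -- Regularity at infinity gives `r b = x³ a` with forms of degree `d` and `b(0, 1, 0) ≠ 0`. The
  -- right side has weight at most `3q + (q + 1) d`, and `b` has leading term a multiple of `y^d`,
  -- so `r` has weight at most `3q`.
  have hinf : r ∈ weightLT q F (3 * q + 1) := by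
    have hmem : f ∈ localRing (infPoint q hq0 F) := hreg _ fun b h hb hP => by
      rw [affinePoint_eq_pointOf] at hP
      exact pointOf_ne_infPoint hq0 _ hP.symm
    obtain ⟨d, a, b, ha, hb, hbP, h⟩ := hmem
    have hb' : (MvPolynomial.aeval ![0, 1, 0] b : F) ≠ 0 := by
      intro hc
      refine hbP ?_
      rw [infPoint, vanishes_mk_iff hb]
      have : (![0, 1, 0] : Fin 3 → AlgebraicClosure F) =
          algebraMap F (AlgebraicClosure F) ∘ ![0, 1, 0] := by
        ext i; fin_cases i <;> simp
      rw [this, MvPolynomial.aeval_algebraMap_apply, hc, map_zero]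
    refine mem_weightLT_of_mul_mem (by omega) hb' (ringDehom_sub_mem_weightLT hb) ?_
    have hrb : r * ringDehom q b = (ringX q F ^ 3 * ringY q F ^ 0) * ringDehom q a := hinj (by
      rw [pow_zero, mul_one, map_mul, map_mul, map_pow, hr, algebraMap_ringDehom,
        algebraMap_ringDehom, ← h, ← coordX_eq]; ring)
    rw [hrb, show 3 * q + 1 + (q + 1) * d = 3 * q + ((q + 1) * d + 1) by ring]
    exact mul_mem_weightLT (monomial_mem_weightLT (by omega)) (ringDehom_mem_weightLT ha)
  have hcoef : ∀ i j, 3 * q + 1 ≤ q * i + (q + 1) * j → coef i j r = 0 :=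
    (mem_weightLT_iff (by omega)).1 hinf
  refine ⟨coef 0 1 r, coef 1 1 r, coef 0 2 r, coef 3 0 r, ?_⟩
  rw [← hr]
  congr 1
  set r' := coef 0 1 r • ringY q F + coef 1 1 r • (ringX q F * ringY q F)
    + coef 0 2 r • ringY q F ^ 2 + coef 3 0 r • ringX q F ^ 3 with hr'
  have key : ∀ i j, coef i j r = coef i j r' := by
    intro i j
    have e1 := coef_monomial (q := q) (F := F) (i := 0) (by omega) 1 i j
    have e2 := coef_monomial (q := q) (F := F) (i := 1) (by omega) 1 i j
    have e3 := coef_monomial (q := q) (F := F) (i := 0) (by omega) 2 i j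
    have e4 := coef_monomial (q := q) (F := F) (i := 3) (by omega) 0 i j
    simp only [pow_zero, one_mul, pow_one, mul_one] at e1 e2 e3 e4
    rw [hr', map_add, map_add, map_add, map_smul, map_smul, map_smul, map_smul, e1, e2, e3, e4]
    rcases lt_or_ge (q * i + (q + 1) * j) (3 * q + 1) with hlt | hge
    · have hi : i < 4 := by by_contra! hc; nlinarith [Nat.zero_le ((q + 1) * j)]
      have hj : j < 3 := by by_contra! hc; nlinarith [Nat.zero_le (q * i)]
      -- The remaining pairs are the four monomials of `r'`, the powers `1, x, x²` excluded at the
      -- origin, and pairs whose weight exceeds `3q`.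
      interval_cases i <;> interval_cases j <;> first | omega | simp [horigin]
    · rw [hcoef i j hge]
      have n1 : ¬ (i = 0 ∧ j = 1) := by rintro ⟨rfl, rfl⟩; omega
      have n2 : ¬ (i = 1 ∧ j = 1) := by rintro ⟨rfl, rfl⟩; omega
      have n3 : ¬ (i = 0 ∧ j = 2) := by rintro ⟨rfl, rfl⟩; omega
      have n4 : ¬ (i = 3 ∧ j = 0) := by rintro ⟨rfl, rfl⟩; omega
      simp [n1, n2, n3, n4]
  rw [← mk_normalForm r, ← mk_normalForm r']
  congr 1
  ext i j
  exact key i j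

end RiemannRoch

/-! ### A function with many zeros -/

section Witness

variable {q : ℕ} {F : Type*} [Field F]

theorem isDomain_coordRing (hq : 2 ≤ q) (F : Type*) [Field F] : IsDomain (CoordRing q F) :=
  AdjoinRoot.isDomain_of_prime (affineEquation_irreducible hq F).prime

theorem ringX_ne_zero (hq : 1 ≤ q) (F : Type*) [Field F] : ringX q F ≠ 0 := by
  intro h
  have := coef_monomial (q := q) (F := F) (i := 1) hq 0 1 0
  simp [h] at this

theorem isUnit_coordX (hq : 2 ≤ q) (F : Type*) [Field F] : IsUnit (coordX q F) :=
  have := isDomain_coordRing hq F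
  IsLocalization.map_units (FunField q F)
    (⟨ringX q F, mem_nonZeroDivisors_of_ne_zero (ringX_ne_zero (by omega) F)⟩ :
      nonZeroDivisors (CoordRing q F))

/-- Modulo `x` and `y - b` the coordinate ring consists of constants: reduction and evaluation at
`(0, b)` agree on the variables, hence everywhere. -/
theorem mem_span_of_evalHom_eq_zero {b : F} (h : b ^ q + b = 0 ^ (q + 1)) {r : CoordRing q F}
    (hr : evalHom 0 b h r = 0) :
    ∃ s t : CoordRing q F, s * ringX q F + t * (ringY q F - algebraMap F _ b) = r := by
  rw [← Ideal.mem_span_pair]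
  set I : Ideal (CoordRing q F) := Ideal.span {ringX q F, ringY q F - algebraMap F _ b} with hI
  obtain ⟨p, rfl⟩ := ringDehom_surjective r
  have key : (Ideal.Quotient.mkₐ F I).comp (ringDehom q) =
      ((Algebra.ofId F (CoordRing q F ⧸ I)).comp (evalHom 0 b h)).comp (ringDehom q) := by
    refine MvPolynomial.algHom_ext fun i => ?_
    have hX : Ideal.Quotient.mk I (ringX q F) = 0 :=
      Ideal.Quotient.eq_zero_iff_mem.2 (Ideal.subset_span (by simp))
    have hY : Ideal.Quotient.mk I (ringY q F) = Ideal.Quotient.mk I (algebraMap F _ b) :=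
      Ideal.Quotient.eq.2 (Ideal.subset_span (by simp))
    fin_cases i
    · simp [ringDehom_apply, evalHom_ringX, hX]
    · simp [ringDehom_apply, evalHom_ringY, hY]
    · simp [ringDehom_apply]
  have := DFunLike.congr_fun key p
  rw [AlgHom.comp_apply, AlgHom.comp_apply, AlgHom.comp_apply, hr, map_zero] at this
  exact Ideal.Quotient.eq_zero_iff_mem.1 this

/-- The polynomial `X^|F| - X` already has the `|F|` elements of `F` as roots and admits no further
one. -/
theorem mem_range_of_pow_card [Fintype F] {K : Type*} [Field K] [Algebra F K] {b : K}
    (hb : b ^ Fintype.card F = b) : ∃ a : F, algebraMap F K a = b := by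
  classical
  by_contra! hc
  have hS : (insert b (Finset.univ.image (algebraMap F K))).card = Fintype.card F + 1 := by
    rw [Finset.card_insert_of_notMem (by simpa using hc),
      Finset.card_image_of_injective _ (algebraMap F K).injective, Finset.card_univ]
  have hle := card_root_set_le (S := insert b (Finset.univ.image (algebraMap F K)))
    (Polynomial.X ^ Fintype.card F - Polynomial.X)
    (FiniteField.X_pow_card_sub_X_ne_zero K Fintype.one_lt_card)
    (FiniteField.X_pow_card_sub_X_natDegree_eq K Fintype.one_lt_card).le (by
      intro w hw
      rcases Finset.mem_insert.1 hw with rfl | hw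
      · simp [hb]
      · obtain ⟨a, -, rfl⟩ := Finset.mem_image.1 hw
        simp [← map_pow, FiniteField.pow_card])
  omega

/-- The function `y (y - c) / x³` equals `(y - c) x^(q-2) / (y^(q-1) + 1)`. -/
theorem mul_eq_of_mul_coordX_eq (hq : 2 ≤ q) {f : FunField q F} {c : F}
    (hf : f * coordX q F ^ 3 = algebraMap (CoordRing q F) (FunField q F)
      (ringY q F * (ringY q F - algebraMap F _ c))) :
    f * algebraMap (CoordRing q F) (FunField q F) (ringY q F ^ (q - 1) + 1) =
      algebraMap (CoordRing q F) (FunField q F)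
        ((ringY q F - algebraMap F _ c) * ringX q F ^ (q - 2)) := by
  have hX : ringX q F ^ (q - 2) * ringX q F ^ 3 = ringY q F ^ q + ringY q F := by
    rw [← pow_add, ← ringX_pow, show q - 2 + 3 = q + 1 by omega]
  have hY : ringY q F * ringY q F ^ (q - 1) = ringY q F ^ q := by
    rw [← pow_succ', show q - 1 + 1 = q by omega]
  have key : ringY q F * (ringY q F - algebraMap F _ c) * (ringY q F ^ (q - 1) + 1) =
      (ringY q F - algebraMap F _ c) * ringX q F ^ (q - 2) * ringX q F ^ 3 := by
    linear_combination (ringY q F - algebraMap F _ c) * hY - (ringY q F - algebraMap F _ c) * hX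
  have key' := congrArg (algebraMap (CoordRing q F) (FunField q F)) key
  rw [map_mul, ← hf, map_mul _ _ (ringX q F ^ 3), map_pow _ (ringX q F), ← coordX_eq,
    mul_right_comm] at key'
  exact ((isUnit_coordX hq F).pow 3).mul_right_cancel key'

variable [Fintype F]

/-- At the points of the curve on the line `X₁ = 0`, other than `(0 : 1 : 0)`, the function `x` is
a local parameter. -/
theorem maxIdeal_le_span_coordX (hF : Fintype.card F = q ^ 2) (hq : 2 ≤ q) {b : F}
    (h : b ^ q + b = 0 ^ (q + 1)) : maxIdeal (affinePoint q 0 b h) ≤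
      Submodule.span (localRing (affinePoint q 0 b h)) {coordX q F} := by
  rw [affinePoint_eq_pointOf]
  set ψ := (Algebra.ofId F (AlgebraicClosure F)).comp (evalHom 0 b h) with hψ
  intro g hg
  obtain ⟨r, s, hs, hr, hgs⟩ := (mem_maxIdeal_pointOf_iff ψ g).1 hg
  have hr' : evalHom 0 b h r = 0 := by
    rw [hψ, AlgHom.comp_apply] at hr
    exact (algebraMap F (AlgebraicClosure F)).injective (hr.trans (map_zero _).symm)
  obtain ⟨t, t', rfl⟩ := mem_span_of_evalHom_eq_zero h hr'
  set z := ringY q F - algebraMap F _ b with hz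
  have hz0 : ψ z = 0 := by
    rw [hz, map_sub, AlgHom.commutes, hψ, AlgHom.comp_apply, evalHom_ringY]
    exact sub_self _
  -- The ideal of the point is generated by `x` and `z = y - b`. By additivity of the `q`-th power
  -- the curve has the same equation in `z`; as `z^(q-1) + 1` is a unit at the point, `z` is a
  -- multiple of `x`.
  have hzq : z * (z ^ (q - 1) + 1) = ringX q F ^ (q + 1) := by
    have hb' : algebraMap F (CoordRing q F) b ^ q + algebraMap F _ b = 0 := by
      rw [← map_pow, ← map_add, h, zero_pow (Nat.succ_ne_zero q), map_zero]
    have h1 : z * (z ^ (q - 1) + 1) = z ^ q + z := by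
      obtain ⟨k, rfl⟩ : ∃ k, q = k + 1 := ⟨q - 1, by omega⟩
      rw [Nat.add_sub_cancel]; ring
    rw [h1, hz, sub_pow_of_card hF, ringX_pow]
    linear_combination -hb'
  obtain ⟨x', hx'⟩ := isUnit_coordX hq F
  have hinv : coordX q F * (↑x'⁻¹ : FunField q F) = 1 := by rw [← hx']; exact x'.mul_inv
  refine Submodule.mem_span_singleton.2 ⟨⟨g * ↑x'⁻¹, ?_⟩, ?_⟩
  · refine (mem_localRing_pointOf_iff ψ _).2
      ⟨t * (z ^ (q - 1) + 1) + t' * ringX q F ^ q, s * (z ^ (q - 1) + 1), ?_, ?_⟩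
    · rw [map_mul, map_add, map_pow, hz0, zero_pow (by omega), zero_add, map_one, mul_one]
      exact hs
    · have h2 : (t * ringX q F + t' * z) * (z ^ (q - 1) + 1) =
          ringX q F * (t * (z ^ (q - 1) + 1) + t' * ringX q F ^ q) := by
        linear_combination t' * hzq
      have h3 := congrArg (algebraMap (CoordRing q F) (FunField q F)) h2
      rw [map_mul, map_mul, ← hgs, ← coordX_eq] at h3
      rw [map_mul]
      linear_combination (↑x'⁻¹ : FunField q F) * h3 + algebraMap (CoordRing q F) (FunField q F)
        (t * (z ^ (q - 1) + 1) + t' * ringX q F ^ q) * hinv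
  · rw [Subalgebra.smul_def, smul_eq_mul]
    linear_combination g * hinv

variable [DecidableEq F]

/-- The functions `y (y - c) / x³` lie in `ℒ(3(P₂ + ⋯ + P_q))`. -/
theorem mem_riemannRoch_of_mul_eq (hF : Fintype.card F = q ^ 2) (hq : 4 ≤ q) {f : FunField q F}
    {c : F} (hf : f * coordX q F ^ 3 = algebraMap (CoordRing q F) (FunField q F)
      (ringY q F * (ringY q F - algebraMap F _ c))) : f ∈ riemannRoch (divG q F 3) := by
  have hq0 : q ≠ 0 := by omega
  have hf' := mul_eq_of_mul_coordX_eq (by omega) hf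
  rw [riemannRoch, Submodule.mem_iInf]
  intro P
  rw [Submodule.restrictScalars_mem]
  by_cases hP : ∀ (b : F) (h : b ^ q + b = 0 ^ (q + 1)), b ≠ 0 → P ≠ affinePoint q 0 b h
  · rw [divG_apply_of_ne 3 P hP, neg_zero, mem_ordGE_zero]
    rcases eq_infPoint_or_pointOf hq0 P with rfl | ⟨ψ, rfl⟩
    -- At infinity the pole-free expression `(y - c) x^(q-2) / (y^(q-1) + 1)` is homogenised in
    -- degree `q - 1`; its denominator takes the value 1 at `(0, 1, 0)`.
    · refine ⟨q - 1, (MvPolynomial.X 1 - MvPolynomial.C c * MvPolynomial.X 2) *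
        MvPolynomial.X 0 ^ (q - 2), MvPolynomial.X 1 ^ (q - 1) + MvPolynomial.X 2 ^ (q - 1),
        ?_, ?_, ?_, ?_⟩
      · have h1 : (MvPolynomial.X 1 - MvPolynomial.C c * MvPolynomial.X 2 :
            MvPolynomial (Fin 3) F).IsHomogeneous 1 :=
          .sub (MvPolynomial.isHomogeneous_X _ _) (MvPolynomial.isHomogeneous_C_mul_X _ _)
        have := h1.mul ((MvPolynomial.isHomogeneous_X F (0 : Fin 3)).pow (q - 2))
        rwa [show 1 + 1 * (q - 2) = q - 1 by omega] at this
      · exact .add (by simpa using (MvPolynomial.isHomogeneous_X F (1 : Fin 3)).pow (q - 1))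
          (by simpa using (MvPolynomial.isHomogeneous_X F (2 : Fin 3)).pow (q - 1))
      · rw [infPoint, vanishes_mk_iff (d := q - 1)]
        · simp [show q - 1 ≠ 0 by omega]
        · exact .add (by simpa using (MvPolynomial.isHomogeneous_X F (1 : Fin 3)).pow (q - 1))
            (by simpa using (MvPolynomial.isHomogeneous_X F (2 : Fin 3)).pow (q - 1))
      · rw [← algebraMap_ringDehom, ← algebraMap_ringDehom]
        convert hf' using 2
        · simp [ringDehom_apply]
        · simp [ringDehom_apply]
    · rw [mem_localRing_pointOf_iff]
      by_cases hx : ψ (ringX q F) = 0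
      -- The same expression serves where `x = 0`. If its denominator vanished, then `y ≠ 0` and
      -- `y^q = -y`, so `y^(q²) = y`; the point would be rational and hence one of the excluded
      -- `P_i`.
      · refine ⟨_, _, ?_, hf'⟩
        intro hy
        rw [map_add, map_pow, map_one] at hy
        have hy1 : ψ (ringY q F) ^ q + ψ (ringY q F) = 0 := by
          have : ψ (ringY q F) ^ q = ψ (ringY q F) * ψ (ringY q F) ^ (q - 1) := by
            rw [← pow_succ']; congr 1; omega
          rw [this]; linear_combination ψ (ringY q F) * hy
        have hy0 : ψ (ringY q F) ≠ 0 := by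
          intro h0
          rw [h0, zero_pow (by omega)] at hy
          simp at hy
        obtain ⟨b, hb⟩ := mem_range_of_pow_card (F := F) (b := ψ (ringY q F)) (by
          rw [hF, sq, pow_mul, eq_neg_of_add_eq_zero_left hy1, ← zero_sub, sub_pow_of_card hF,
            zero_pow hq0, eq_neg_of_add_eq_zero_left hy1]
          ring)
        have hb1 : b ^ q + b = 0 ^ (q + 1) := by
          rw [zero_pow (Nat.succ_ne_zero q)]
          apply (algebraMap F (AlgebraicClosure F)).injective
          rw [map_add, map_pow, hb, hy1, map_zero]
        refine hP b hb1 (fun h0 => hy0 (by rw [← hb, h0, map_zero])) (Subtype.ext ?_)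
        simp only [pointOf, affinePoint, affineProj, hx, ← hb, map_zero]
      · refine ⟨ringY q F * (ringY q F - algebraMap F _ c), ringX q F ^ 3, ?_, ?_⟩
        · rw [map_pow]; exact pow_ne_zero _ hx
        · rw [map_pow, ← coordX_eq]; exact hf
  · push Not at hP
    obtain ⟨b, h, hb0, rfl⟩ := hP
    rw [divG_apply_affinePoint 3 (by rw [h, zero_pow (Nat.succ_ne_zero q)]) hb0,
      mem_ordGE_neg_three]
    intro g hg
    -- The cube of the maximal ideal lies in the multiples of `x³`, so only the regularity of `f x³`
    -- has to be checked.
    have hg' := pow_le_pow_left' (maxIdeal_le_span_coordX hF (by omega) h) 3 hg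
    rw [Submodule.span_pow, Set.singleton_pow, Submodule.mem_span_singleton] at hg'
    obtain ⟨⟨t, ht⟩, rfl⟩ := hg'
    rw [Subalgebra.smul_def, smul_eq_mul, mul_left_comm, hf]
    refine mul_mem ht ?_
    rw [affinePoint_eq_pointOf]
    exact algebraMap_mem_localRing _ _

end Witness

/-! ### Values -/

section Value

variable {q : ℕ} {F : Type*} [Field F]

/-- Since `a ≠ 0`, the function `x³` is a unit at the point and the value of `f` is `r(a, b) / a³`.
-/
theorem hasValue_iff {a b : F} (ha : a ≠ 0) (h : b ^ q + b = a ^ (q + 1)) {f : FunField q F}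
    {r : CoordRing q F} (hr : f * coordX q F ^ 3 = algebraMap _ _ r) (c : F) :
    HasValue (affinePoint q a b h) f c ↔ c * a ^ 3 = evalHom a b h r := by
  have hmul : (f - algebraMap F (FunField q F) c) * algebraMap _ _ (ringX q F ^ 3) =
      algebraMap (CoordRing q F) _ (r - algebraMap F _ c * ringX q F ^ 3) := by
    rw [IsScalarTower.algebraMap_apply F (CoordRing q F) (FunField q F), map_sub, ← hr, map_mul,
      map_pow, ← coordX_eq]
    ring
  have hinj := (algebraMap F (AlgebraicClosure F)).injective
  rw [HasValue, affinePoint_eq_pointOf, mem_maxIdeal_pointOf_iff]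
  constructor
  · rintro ⟨t, s, hs, ht, hst⟩
    have h1 : (r - algebraMap F _ c * ringX q F ^ 3) * s = ringX q F ^ 3 * t := by
      apply IsFractionRing.injective (CoordRing q F) (FunField q F)
      rw [map_mul, ← hmul, map_mul, ← hst]; ring
    have h2 := congrArg (evalHom a b h) h1
    have ht' : evalHom a b h t = 0 := hinj (ht.trans (map_zero _).symm)
    have hs' : evalHom a b h s ≠ 0 := fun h0 => hs (by
      rw [AlgHom.comp_apply, h0, map_zero])
    rw [map_mul, map_mul, ht', mul_zero] at h2
    have h3 := (mul_eq_zero.1 h2).resolve_right hs'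
    rw [map_sub, map_mul, map_pow, evalHom_ringX, AlgHom.commutes] at h3
    exact (sub_eq_zero.1 h3).symm
  · intro hc
    refine ⟨_, _, ?_, ?_, hmul⟩
    · rw [AlgHom.comp_apply, map_pow, evalHom_ringX]
      exact fun h0 => pow_ne_zero 3 ha (hinj (h0.trans (map_zero _).symm))
    · rw [AlgHom.comp_apply, map_sub, map_mul, map_pow, evalHom_ringX, AlgHom.commutes, ← hc]
      simp

end Value

/-! ### Zeros on the orbit -/

section Orbit

variable {q : ℕ} {F : Type*} [Field F]

theorem second_coord_ne_zero {u v : F} (hq : q ≠ 0) (hu : u ≠ 0)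
    (huv : v ^ q + v = u ^ (q + 1)) : v ≠ 0 := by
  rintro rfl
  rw [zero_pow hq, add_zero] at huv
  exact pow_ne_zero _ hu huv.symm

/-- A form of degree 1 is a combination of the variables, so on affine points the cubics give the
same expressions as the numerators of functions in the Riemann–Roch space, and one count of zeros
serves both. -/
theorem linearSystem_three {V : MvPolynomial (Fin 3) F} (hV : V ∈ linearSystem F 3) :
    V.IsHomogeneous 3 ∧ ∃ a b c ε : F, ¬ (a = 0 ∧ b = 0 ∧ c = 0 ∧ ε = 0) ∧ ∀ x y : F,
      MvPolynomial.aeval ![x, y, 1] V = a * y + b * (x * y) + c * y ^ 2 + ε * x ^ 3 := by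
  obtain ⟨hV0, g, ε, hg, rfl⟩ := hV
  refine ⟨?_, ?_⟩
  · exact (((MvPolynomial.isHomogeneous_X F (1 : Fin 3)).mul
      (MvPolynomial.isHomogeneous_X F (2 : Fin 3))).mul hg).add
      (by
        simpa using (MvPolynomial.isHomogeneous_C (Fin 3) ε).mul
          ((MvPolynomial.isHomogeneous_X F (0 : Fin 3)).pow 3))
  have hg' : g ∈ MvPolynomial.homogeneousSubmodule (Fin 3) F 1 := hg
  rw [MvPolynomial.homogeneousSubmodule_one_eq_span_X, Submodule.mem_span_range_iff_exists_fun]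
    at hg'
  obtain ⟨c, rfl⟩ := hg'
  rw [Fin.sum_univ_three] at *
  refine ⟨c 2, c 0, c 1, ε, ?_, fun x y => ?_⟩
  · rintro ⟨h2, h0, h1, h⟩
    exact hV0 (by simp [h2, h0, h1, h])
  · simp [MvPolynomial.smul_eq_C_mul]
    ring

variable [Fintype F]

theorem orderOf_eq_of_card (hF : Fintype.card F = q ^ 2) {ω : Fˣ}
    (hω : ∀ z : Fˣ, z ∈ Subgroup.zpowers ω) : orderOf ω = q ^ 2 - 1 := by
  classical
  rw [orderOf_eq_card_of_forall_mem_zpowers hω, Nat.card_eq_fintype_card, Fintype.card_units, hF]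

theorem pow_succ_injective (hF : Fintype.card F = q ^ 2) {ω : Fˣ}
    (hω : ∀ z : Fˣ, z ∈ Subgroup.zpowers ω) :
    Function.Injective fun i : Fin (q ^ 2 - 1) => (ω : F) ^ ((i : ℕ) + 1) := by
  intro i j hij
  have h1 : ω ^ ((i : ℕ) + 1) = ω ^ ((j : ℕ) + 1) := Units.ext (by simpa using hij)
  have h2 : ω ^ (i : ℕ) = ω ^ (j : ℕ) := by
    rw [pow_succ ω (i : ℕ), pow_succ ω (j : ℕ)] at h1; exact mul_right_cancel h1
  have := pow_injOn_Iio_orderOf (x := ω) (by simp [orderOf_eq_of_card hF hω])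
    (by simp [orderOf_eq_of_card hF hω]) h2
  exact Fin.ext this

variable [DecidableEq F]

/-- A nonzero function `y (a + b x + c y) + ε x³` has at most `q + 1` zeros on the orbit. -/
theorem card_orbit_zeros_le (hq : 4 ≤ q) (hF : Fintype.card F = q ^ 2) {ω : Fˣ}
    (hω : ∀ z : Fˣ, z ∈ Subgroup.zpowers ω) {u v : F} (hu : u ≠ 0) (hv : v ≠ 0) {a b c ε : F}
    (h0 : ¬ (a = 0 ∧ b = 0 ∧ c = 0 ∧ ε = 0)) {x y : Fin (q ^ 2 - 1) → F}
    (hx : ∀ i, x i = (ω : F) ^ ((i : ℕ) + 1) * u)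
    (hy : ∀ i, y i = ((ω : F) ^ ((i : ℕ) + 1)) ^ (q + 1) * v) :
    (Finset.univ.filter fun i =>
      a * y i + b * (x i * y i) + c * y i ^ 2 + ε * x i ^ 3 = 0).card ≤ q + 1 := by
  rw [← Finset.card_image_of_injective _ (pow_succ_injective hF hω)]
  -- These are the coefficients after substituting `x = w u`, `y = w^(q+1) v` with `w = ω^(i+1)`.
  refine card_zeros_le hq hF (A := a * v) (B := b * (u * v)) (D := c * v ^ 2) (E := ε * u ^ 3)
    ?_ ?_ ?_
  · simpa [hu, hv] using h0
  · simp
  · intro w hw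
    obtain ⟨i, hi, rfl⟩ := Finset.mem_image.1 hw
    rw [← (Finset.mem_filter.1 hi).2, hx, hy]
    ring

theorem le_card_orbit_norm_eq_one (hq : 2 ≤ q) {ω : Fˣ} (hF : Fintype.card F = q ^ 2) :
    q + 1 ≤ (Finset.univ.filter fun i : Fin (q ^ 2 - 1) =>
      ((ω : F) ^ ((i : ℕ) + 1)) ^ (q + 1) = 1).card := by
  have hmul : (q - 1) * (q + 1) = q ^ 2 - 1 := by
    obtain ⟨k, rfl⟩ : ∃ k, q = k + 1 := ⟨q - 1, by omega⟩
    rw [Nat.add_sub_cancel, eq_comm, Nat.sub_eq_iff_eq_add (Nat.pos_of_ne_zero (by positivity))]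
    ring
  have hlt : ∀ k : Fin (q + 1), (q - 1) * ((k : ℕ) + 1) - 1 < q ^ 2 - 1 := fun k => by
    have h1 : (q - 1) * ((k : ℕ) + 1) ≤ (q - 1) * (q + 1) := Nat.mul_le_mul_left _ k.2
    have h2 : 0 < (q - 1) * ((k : ℕ) + 1) := Nat.mul_pos (by omega) (by omega)
    omega
  have hsucc : ∀ k : Fin (q + 1), (q - 1) * ((k : ℕ) + 1) - 1 + 1 = (q - 1) * ((k : ℕ) + 1) :=
    fun k => Nat.succ_pred_eq_of_pos (Nat.mul_pos (by omega) (by omega))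
  -- The exponents `i + 1 = (q - 1)(k + 1)` with `0 ≤ k ≤ q` give `q + 1` solutions, because `(q -
  -- 1)(q + 1) = q² - 1`. The index `i` starts at 0, whence the subtraction of 1.
  have := Finset.card_le_card_of_injOn (s := (Finset.univ : Finset (Fin (q + 1))))
    (t := Finset.univ.filter fun i : Fin (q ^ 2 - 1) =>
      ((ω : F) ^ ((i : ℕ) + 1)) ^ (q + 1) = 1)
    (fun k => ⟨(q - 1) * ((k : ℕ) + 1) - 1, hlt k⟩) ?_ ?_
  · simpa using this
  · intro k _
    simp only [Finset.coe_filter, Finset.mem_univ, true_and, Set.mem_ofPred_eq]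
    rw [hsucc, ← pow_mul, show (q - 1) * ((k : ℕ) + 1) * (q + 1) =
      (q - 1) * (q + 1) * ((k : ℕ) + 1) by ring, hmul, pow_mul, ← hF,
      FiniteField.pow_card_sub_one_eq_one _ ω.ne_zero, one_pow]
  · intro k _ l _ hkl
    have h1 := congrArg (fun z : Fin (q ^ 2 - 1) => (z : ℕ) + 1) hkl
    simp only [hsucc] at h1
    have := Nat.eq_of_mul_eq_mul_left (by omega : 0 < q - 1) h1
    exact Fin.ext (by omega)

/-- The words of the code are the values of `(y (a + b x + c y) + ε x³) / x³`. -/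
theorem exists_of_mem_agCode (hq : 4 ≤ q) (hF : Fintype.card F = q ^ 2) {ω : Fˣ}
    {u v : F} (hu : u ≠ 0) (huv : v ^ q + v = u ^ (q + 1)) {w : Fin (q ^ 2 - 1) → F}
    (hw : w ∈ agCode (divD hF ω huv) (divG q F 3)) {x y : Fin (q ^ 2 - 1) → F}
    (hx : ∀ i, x i = (ω : F) ^ ((i : ℕ) + 1) * u)
    (hy : ∀ i, y i = ((ω : F) ^ ((i : ℕ) + 1)) ^ (q + 1) * v) :
    ∃ a b c ε : F, ∀ i, w i * x i ^ 3 =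
      a * y i + b * (x i * y i) + c * y i ^ 2 + ε * x i ^ 3 := by
  obtain ⟨f, hf, hval⟩ := hw
  obtain ⟨a, b, c, ε, h⟩ := exists_of_mem_riemannRoch hq hf
  refine ⟨a, b, c, ε, fun i => ?_⟩
  have := hval i
  rw [divD, hasValue_iff (mul_ne_zero (pow_ne_zero _ ω.ne_zero) hu) _ h] at this
  rw [hx, hy, this]
  simp only [map_add, map_smul, map_mul, map_pow, evalHom_ringX, evalHom_ringY, smul_eq_mul]

/-- The word of the values of `y (y - v) / x³`. -/
theorem exists_mem_agCode (hq : 4 ≤ q) (hF : Fintype.card F = q ^ 2) {ω : Fˣ}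
    {u v : F} (hu : u ≠ 0) (huv : v ^ q + v = u ^ (q + 1)) {x y : Fin (q ^ 2 - 1) → F}
    (hx : ∀ i, x i = (ω : F) ^ ((i : ℕ) + 1) * u)
    (hy : ∀ i, y i = ((ω : F) ^ ((i : ℕ) + 1)) ^ (q + 1) * v) :
    (fun i => y i * (y i - v) / x i ^ 3) ∈ agCode (divD hF ω huv) (divG q F 3) := by
  obtain ⟨t, ht⟩ := (isUnit_coordX (by omega : 2 ≤ q) F).pow 3
  have hf : algebraMap (CoordRing q F) (FunField q F) (ringY q F * (ringY q F - algebraMap F _ v))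
      * ↑t⁻¹ * coordX q F ^ 3 = algebraMap (CoordRing q F) (FunField q F)
      (ringY q F * (ringY q F - algebraMap F _ v)) := by
    rw [← ht, mul_assoc, Units.inv_mul, mul_one]
  refine ⟨_, mem_riemannRoch_of_mul_eq hF hq hf, fun i => ?_⟩
  have hx0 : (ω : F) ^ ((i : ℕ) + 1) * u ≠ 0 := mul_ne_zero (pow_ne_zero _ ω.ne_zero) hu
  rw [divD, hasValue_iff hx0 _ hf]
  beta_reduce
  rw [hx i, div_mul_cancel₀ _ (pow_ne_zero 3 hx0), hy i]
  simp only [map_sub, map_mul, evalHom_ringY, AlgHom.commutes, Algebra.algebraMap_self,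
    RingHom.id_apply]

end Orbit

end HermitianCode

open HermitianCode in
theorem proposition3 (q : ℕ) (hq : 4 ≤ q) (F : Type*) [Field F] [Fintype F] [DecidableEq F]
    (hF : Fintype.card F = q ^ 2)
    (ω : Fˣ) (hω : ∀ z : Fˣ, z ∈ Subgroup.zpowers ω)
    (u v : F) (hu : u ≠ 0) (huv : v ^ q + v = u ^ (q + 1)) :
    HermitianCode.IsMinDistance
        (HermitianCode.agCode (HermitianCode.divD hF ω huv) (HermitianCode.divG q F 3))
        (q ^ 2 - q - 2) ∧
      q ^ 2 - q - 2 = q ^ 2 - 1 - (3 - 2) * (q + 1) ∧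
      ∀ V ∈ HermitianCode.linearSystem F 3,
        {P ∈ Set.range (HermitianCode.divD hF ω huv) |
          HermitianCode.Vanishes V P.1}.ncard ≤ q + 1 := by
  have hv : v ≠ 0 := second_coord_ne_zero (by omega) hu huv
  have hnum : q ^ 2 - q - 2 = q ^ 2 - 1 - (3 - 2) * (q + 1) := by omega
  have hq2 : 4 * q ≤ q ^ 2 := by nlinarith
  let x : Fin (q ^ 2 - 1) → F := fun i => (ω : F) ^ ((i : ℕ) + 1) * u
  let y : Fin (q ^ 2 - 1) → F := fun i => ((ω : F) ^ ((i : ℕ) + 1)) ^ (q + 1) * v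
  have hx : ∀ i, x i = (ω : F) ^ ((i : ℕ) + 1) * u := fun _ => rfl
  have hy : ∀ i, y i = ((ω : F) ^ ((i : ℕ) + 1)) ^ (q + 1) * v := fun _ => rfl
  have hx0 : ∀ i, x i ≠ 0 := fun i => mul_ne_zero (pow_ne_zero _ ω.ne_zero) hu
  have hy0 : ∀ i, y i ≠ 0 := fun i => mul_ne_zero (pow_ne_zero _ (pow_ne_zero _ ω.ne_zero)) hv
  have hnorm : ∀ w : Fin (q ^ 2 - 1) → F,
      (Finset.univ.filter fun i => w i = 0).card + hammingNorm w = q ^ 2 - 1 := fun w => by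
    have := Finset.card_filter_add_card_filter_not (s := Finset.univ) fun i => w i = 0
    rw [Finset.card_univ, Fintype.card_fin] at this
    exact this
  have hlow : ∀ w ∈ agCode (divD hF ω huv) (divG q F 3), ∀ w' ∈ agCode (divD hF ω huv) (divG q F 3),
      w ≠ w' → q ^ 2 - q - 2 ≤ hammingDist w w' := by
    intro w hw w' hw' hne
    rw [hammingDist_comm, hammingDist_eq_hammingNorm, neg_add_eq_sub]
    obtain ⟨a, b, c, ε, h⟩ := exists_of_mem_agCode hq hF hu huv (Submodule.sub_mem _ hw hw') hx hy
    have h0 : ¬ (a = 0 ∧ b = 0 ∧ c = 0 ∧ ε = 0) := by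
      rintro ⟨rfl, rfl, rfl, rfl⟩
      refine hne (sub_eq_zero.1 (funext fun i => ?_))
      have := h i
      simp only [zero_mul, add_zero] at this
      exact (mul_eq_zero.1 this).resolve_right (pow_ne_zero 3 (hx0 i))
    have hcard := card_orbit_zeros_le hq hF hω hu hv h0 hx hy
    have hsub : (Finset.univ.filter fun i => (w - w') i = 0).card ≤ q + 1 := by
      refine le_trans (Finset.card_le_card fun i hi => ?_) hcard
      rw [Finset.mem_filter] at hi ⊢
      exact ⟨hi.1, by rw [← h i, hi.2, zero_mul]⟩
    have := hnorm (w - w')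
    omega
  refine ⟨⟨?_, ?_⟩, hnum, ?_⟩
  · have hmem := exists_mem_agCode hq hF hu huv hx hy
    set w : Fin (q ^ 2 - 1) → F := fun i => y i * (y i - v) / x i ^ 3 with hw
    have hne : w ≠ 0 := by
      intro h
      -- A zero at the first point, where `w = ω`, would give `ω^(q+1) = 1`, but `ω` has order `q² -
      -- 1 > q + 1`.
      have h1 : y ⟨0, by omega⟩ * (y ⟨0, by omega⟩ - v) / x ⟨0, by omega⟩ ^ 3 = 0 := congrFun h _
      rw [div_eq_zero_iff, or_iff_left (pow_ne_zero 3 (hx0 _)), mul_eq_zero,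
        or_iff_right (hy0 _), sub_eq_zero, hy, mul_eq_right₀ hv, zero_add, pow_one] at h1
      have h2 : ω ^ (q + 1) = 1 := Units.ext (by simpa using h1)
      have h3 := Nat.le_of_dvd (by omega) (orderOf_dvd_of_pow_eq_one h2)
      rw [orderOf_eq_of_card hF hω] at h3
      omega
    refine ⟨w, hmem, 0, Submodule.zero_mem _, hne,
      le_antisymm ?_ (hlow w hmem 0 (Submodule.zero_mem _) hne)⟩
    rw [hammingDist_zero_right]
    -- Where `w^(q+1) = 1` the second coordinate equals `v`, so the factor `y - v` vanishes.
    have hzeros : q + 1 ≤ (Finset.univ.filter fun i => w i = 0).card := by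
      refine (le_card_orbit_norm_eq_one (by omega) (ω := ω) hF).trans
        (Finset.card_le_card fun i hi => ?_)
      rw [Finset.mem_filter] at hi ⊢
      refine ⟨hi.1, ?_⟩
      simp only [hw, hy, hi.2]
      simp
    have := hnorm w
    omega
  · rintro e ⟨w, hw, w', hw', hne, rfl⟩
    exact hlow w hw w' hw' hne
  · intro V hV
    obtain ⟨hV3, a, b, c, ε, h0, h⟩ := linearSystem_three hV
    refine le_trans ?_ (card_orbit_zeros_le hq hF hω hu hv h0 hx hy)
    rw [← Set.ncard_coe_finset]
    refine le_trans (Set.ncard_le_ncard (t := divD hF ω huv '' _) ?_ ?_) (Set.ncard_image_le ?_)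
    · rintro _ ⟨⟨i, rfl⟩, hi⟩
      refine ⟨i, ?_, rfl⟩
      rw [divD, affinePoint_vanishes_iff _ hV3, h] at hi
      simpa using hi
    · exact (Finset.finite_toSet _).image _
    · exact Finset.finite_toSet _
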